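/- Let $(M^5,g)$ be a smooth 5-dimensional Riemannian manifold with Levi-Civita connection $\nabla^g$, equipped with an almost contact metric structure $(\xi,\eta,\varphi)$: $\xi$ is a unit vector field, $\eta=g(\xi,\cdot)$, and $\varphi$ is an endomorphism of $TM$ with $\varphi(\xi)=0$, $\varphi^2=-\mathrm{Id}+\eta\otimes\xi$ and $g(\varphi X,\varphi Y)=g(X,Y)-\eta(X)\eta(Y)$. Put $\Phi(X,Y)=g(X,\varphi Y)$ and $N(X,Y,Z)=g(X,[\varphi,\varphi](Y,Z))+\eta(X)\,d\eta(Y,Z)$, where $[\varphi,\varphi](X,Y)=[\varphi X,\varphi Y]+\varphi^2[X,Y]-\varphi[\varphi X,Y]-\varphi[X,\varphi Y]$; exterior derivatives are normalized by $d\alpha=\sum_i e_i\wedge\nabla^g_{e_i}\alpha$, and $(\alpha\wedge\eta)(X,Y,Z)=\alpha(X,Y)\eta(Z)+\alpha(Y,Z)\eta(X)+\alpha(Z,X)\eta(Y)$ for a 2-form $\alpha$. Assume that $M$ is a generalized quasi-Sasaki manifold, i.e. $\xi$ is a Killing vector field, and $N(X,Y,Z)=0$ and $d\Phi(X,Y,Z)=0$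 for all $X,Y,Z$ orthogonal to $\xi$. Let $\nabla^c$ be the canonical connection $$g(\nabla^c_XY,Z)=g(\nabla^g_XY,Z)+\tfrac12\big\{\big((d\eta-\gamma)\wedge\eta\big)(X,Y,Z)-N(X,Y,Z)\big\},\qquad \gamma(X,Y)=d\Phi(\xi,\varphi X,Y),$$ with torsion $T^c(X,Y,Z)=g(\nabla^c_XY-\nabla^c_YX-[X,Y],Z)$. Let $(e_1,\dots,e_5)$ be local adapted orthonormal frames ($\Phi=e_1\wedge e_2+e_3\wedge e_4$, $\eta=e_5$), let $\Omega^g(X)=(g(\nabla^g_Xe_i,e_j))_{ij}\in\mathfrak{so}(5)=\Lambda^2$, and let $\Gamma(X)=\mathrm{pr}_{\mathfrak u(2)^\perp}(\Omega^g(X))$ be the intrinsic torsion, where $\mathfrak u(2)^\perp$ is the orthogonal complement of $\mathfrak u(2)$ in $\mathfrak{so}(5)$. Let $\Lambda^2_1=\mathbb R\Phi$, $\Lambda^2_2=\{\beta\in\Lambda^2:\Phi\wedge\beta=0,\ *\beta=\eta\wedge\beta\}$, $\Lambda^2_3=\{\beta\in\Lambda^2:*\beta=-\eta\wedge\beta\}$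 (with $*$ the Hodge operator for the orientation $e_1\wedge\dots\wedge e_5$), $\theta(\beta)=*\beta$, $\vartheta(\beta)(X,Y,Z)=3\eta(X)\beta(Y,Z)-*\beta(X,Y,Z)$ and $\mathrm{pr}_{\mathcal W}(\alpha\otimes\beta)=\alpha\otimes\mathrm{pr}_{\mathfrak u(2)^\perp}(\beta)$. Put $\mathcal W_3=\mathrm{pr}_{\mathcal W}\theta(\Lambda^2_1)$, $\mathcal W_4=\mathrm{pr}_{\mathcal W}\theta(\Lambda^2_2)$, $\mathcal W_5=\mathrm{pr}_{\mathcal W}\theta(\Lambda^2_3)$ and $\mathcal W_7=\mathrm{pr}_{\mathcal W}\vartheta(\Lambda^2_2)$. The manifold is of class $\mathcal V$ if $\Gamma\in\mathcal V$ at every point. Then: (a) $T^c$ is totally skew-symmetric, i.e. $T^c(X,Y,Z)+T^c(X,Z,Y)=0$, if and only if $M$ is of class $\mathcal W_3\oplus\mathcal W_4\oplus\mathcal W_5$. (b) $T^c$ is traceless cyclic, i.e. $T^c(X,Y,Z)+T^c(Y,Z,X)+T^c(Z,X,Y)=0$ and $\sum_iT^c(X,e_i,e_i)=0$ for orthonormal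 bases $(e_i)$ of the tangent spaces, if and only if $M$ is of class $\mathcal W_7$. -/

import Mathlib

open Bundle NormedSpace
open scoped Manifold ContDiff Bundle Matrix

set_option linter.unusedSectionVars false

noncomputable section LeviCivita

variable {E : Type*} [NormedAddCommGroup E] [NormedSpace ℝ E] [FiniteDimensional ℝ E]
  {H : Type*} [TopologicalSpace H] (I : ModelWithCorners ℝ E H)
  {M : Type*} [TopologicalSpace M] [ChartedSpace H M] [IsManifold I ∞ M]
  [RiemannianBundle (fun x : M ↦ TangentSpace I x)]
  [IsContMDiffRiemannianBundle I ∞ E (fun x : M ↦ TangentSpace I x)]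

instance tangentSpace_finiteDimensional (x : M) : FiniteDimensional ℝ (TangentSpace I x) :=
  inferInstanceAs (FiniteDimensional ℝ E)

instance tangentSpace_completeSpace (x : M) : CompleteSpace (TangentSpace I x) :=
  FiniteDimensional.complete ℝ _

/-- The right-hand side of the Koszul formula for `g(∇_X Y, Z)` at the point `x`. -/
def koszul (X Y Z : Π x : M, TangentSpace I x) (x : M) : ℝ :=
  (1 / 2) * (d% (fun y ↦ inner ℝ (Y y) (Z y)) x (X x)
    + d% (fun y ↦ inner ℝ (Z y) (X y)) x (Y x)
    - d% (fun y ↦ inner ℝ (X y) (Y y)) x (Z x)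
    + inner ℝ (VectorField.mlieBracket I X Y x) (Z x)
    - inner ℝ (VectorField.mlieBracket I Y Z x) (X x)
    + inner ℝ (VectorField.mlieBracket I Z X x) (Y x))

variable {I}

lemma mdifferentiableAt_inner {x : M} {X Y : Π x : M, TangentSpace I x}
    (hX : MDiffAt (T% X) x) (hY : MDiffAt (T% Y) x) :
    MDiffAt (fun y ↦ inner ℝ (X y) (Y y)) x :=
  MDifferentiableAt.inner_bundle (IB := I) (F := E) (E := fun x : M ↦ TangentSpace I x) hX hY

lemma koszul_tensorial_left {x : M} {Y Z : Π x : M, TangentSpace I x}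
    (hY : MDiffAt (T% Y) x) (hZ : MDiffAt (T% Z) x) :
    TensorialAt I E (fun X ↦ koszul I X Y Z x) x where
  smul {f X} hf hX := by
    have h1 := mvfderiv_fun_mul hf (mdifferentiableAt_inner hZ hX)
    have h2 := mvfderiv_fun_mul hf (mdifferentiableAt_inner hX hY)
    simp [koszul, inner_smul_left, inner_smul_right, h1, h2,
      VectorField.mlieBracket_smul_left hf hX, VectorField.mlieBracket_smul_right hf hX,
      inner_add_left, real_inner_comm (Z x) (X x)]
    ring
  add {X X'} hX hX' := by
    have h1 := mvfderiv_fun_add (mdifferentiableAt_inner hZ hX) (mdifferentiableAt_inner hZ hX')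
    have h2 := mvfderiv_fun_add (mdifferentiableAt_inner hX hY) (mdifferentiableAt_inner hX' hY)
    simp [koszul, h1, h2, inner_add_left, inner_add_right,
      VectorField.mlieBracket_add_left hX hX', VectorField.mlieBracket_add_right hX hX']
    ring

lemma koszul_tensorial_right {x : M} {X Y : Π x : M, TangentSpace I x}
    (hX : MDiffAt (T% X) x) (hY : MDiffAt (T% Y) x) :
    TensorialAt I E (fun Z ↦ koszul I X Y Z x) x where
  smul {f Z} hf hZ := by
    have h1 := mvfderiv_fun_mul hf (mdifferentiableAt_inner hY hZ)
    have h2 := mvfderiv_fun_mul hf (mdifferentiableAt_inner hZ hX)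
    simp [koszul, inner_smul_left, inner_smul_right, h1, h2,
      VectorField.mlieBracket_smul_left hf hZ, VectorField.mlieBracket_smul_right hf hZ,
      inner_add_left, real_inner_comm (Z x) (Y x)]
    ring
  add {Z Z'} hZ hZ' := by
    have h1 := mvfderiv_fun_add (mdifferentiableAt_inner hY hZ) (mdifferentiableAt_inner hY hZ')
    have h2 := mvfderiv_fun_add (mdifferentiableAt_inner hZ hX) (mdifferentiableAt_inner hZ' hX)
    simp [koszul, h1, h2, inner_add_left, inner_add_right,
      VectorField.mlieBracket_add_left hZ hZ', VectorField.mlieBracket_add_right hZ hZ']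
    ring

open Classical in
/-- `∇Y` at `x`, obtained from the Koszul formula. -/
def leviCivitaFun (Y : Π x : M, TangentSpace I x) (x : M) :
    TangentSpace I x →L[ℝ] TangentSpace I x :=
  if hY : MDiffAt (T% Y) x then
    (InnerProductSpace.toDual ℝ (TangentSpace I x)).symm.toLinearIsometry.toContinuousLinearMap ∘L
      TensorialAt.mkHom₂ (fun X Z ↦ koszul I X Y Z x) x
        (fun _ hZ ↦ koszul_tensorial_left hY hZ) (fun _ hX ↦ koszul_tensorial_right hX hY)
  else 0

lemma inner_leviCivitaFun {x : M} {X Y Z : Π x : M, TangentSpace I x}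
    (hX : MDiffAt (T% X) x) (hY : MDiffAt (T% Y) x) (hZ : MDiffAt (T% Z) x) :
    inner ℝ (leviCivitaFun Y x (X x)) (Z x) = koszul I X Y Z x := by
  rw [leviCivitaFun, dif_pos hY]
  simp [TensorialAt.mkHom₂_apply _ _ hX hZ]


lemma koszul_add_middle {x : M} {X Y Y' Z : Π x : M, TangentSpace I x}
    (hX : MDiffAt (T% X) x) (hY : MDiffAt (T% Y) x) (hY' : MDiffAt (T% Y') x)
    (hZ : MDiffAt (T% Z) x) :
    koszul I X (Y + Y') Z x = koszul I X Y Z x + koszul I X Y' Z x := by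
  have h1 := mvfderiv_fun_add (mdifferentiableAt_inner hY hZ) (mdifferentiableAt_inner hY' hZ)
  have h2 := mvfderiv_fun_add (mdifferentiableAt_inner hX hY) (mdifferentiableAt_inner hX hY')
  simp [koszul, h1, h2, inner_add_left, inner_add_right,
    VectorField.mlieBracket_add_left hY hY', VectorField.mlieBracket_add_right hY hY']
  ring

lemma koszul_smul_middle {x : M} {f : M → ℝ} {X Y Z : Π x : M, TangentSpace I x}
    (hf : MDiffAt f x) (hX : MDiffAt (T% X) x) (hY : MDiffAt (T% Y) x)
    (hZ : MDiffAt (T% Z) x) :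
    koszul I X (f • Y) Z x =
      f x * koszul I X Y Z x + d% f x (X x) * inner ℝ (Y x) (Z x) := by
  have h1 := mvfderiv_fun_mul hf (mdifferentiableAt_inner hY hZ)
  have h2 := mvfderiv_fun_mul hf (mdifferentiableAt_inner hX hY)
  simp [koszul, inner_smul_left, inner_smul_right, h1, h2,
    VectorField.mlieBracket_smul_left hf hY, VectorField.mlieBracket_smul_right hf hY,
    inner_add_left, real_inner_comm (X x) (Y x)]
  ring

variable (I M) in
/-- The Levi-Civita connection of the Riemannian manifold `M`. -/
def leviCivita : CovariantDerivative I E (TangentSpace I : M → Type _) where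
  toFun := leviCivitaFun
  isCovariantDerivativeOnUniv :=
    { add := by
        intro Y Y' x hY hY' _
        ext v
        refine ext_inner_right ℝ fun w ↦ ?_
        have hv := FiberBundle.mdifferentiableAt_extend I E v
        have hw := FiberBundle.mdifferentiableAt_extend I E w
        have h1 := inner_leviCivitaFun hv (mdifferentiableAt_add_section hY hY') hw
        have h2 := inner_leviCivitaFun hv hY hw
        have h3 := inner_leviCivitaFun hv hY' hw
        have h4 := koszul_add_middle hv hY hY' hw
        simp only [FiberBundle.extend_apply_self] at h1 h2 h3 h4
        rw [add_apply, inner_add_left, h2, h3, ← h4, ← h1]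
      leibniz := by
        intro Y f x hY hf _
        ext v
        refine ext_inner_right ℝ fun w ↦ ?_
        have hv := FiberBundle.mdifferentiableAt_extend I E v
        have hw := FiberBundle.mdifferentiableAt_extend I E w
        have h1 := inner_leviCivitaFun hv (hf.smul_section hY) hw
        have h2 := inner_leviCivitaFun hv hY hw
        have h4 := koszul_smul_middle hf hv hY hw
        simp only [FiberBundle.extend_apply_self] at h1 h2 h4
        rw [h1, h4, add_apply, inner_add_left, smul_apply,
          inner_smul_left, h2, ContinuousLinearMap.smulRight_apply, inner_smul_left]
        rfl }

lemma inner_leviCivita {x : M} {X Y Z : Π x : M, TangentSpace I x}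
    (hX : MDiffAt (T% X) x) (hY : MDiffAt (T% Y) x) (hZ : MDiffAt (T% Z) x) :
    inner ℝ (leviCivita I M Y x (X x)) (Z x) = koszul I X Y Z x :=
  inner_leviCivitaFun hX hY hZ

/-- The Levi-Civita connection is torsion-free. -/
theorem leviCivita_torsion : (leviCivita I M).torsion = 0 := by
  rw [CovariantDerivative.torsion_eq_zero_iff]
  intro X Y x hX hY
  refine ext_inner_right ℝ fun w ↦ ?_
  have hw := FiberBundle.mdifferentiableAt_extend I E w
  have h1 := inner_leviCivita hX hY hw
  have h2 := inner_leviCivita hY hX hw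
  simp only [FiberBundle.extend_apply_self] at h1 h2
  rw [inner_sub_left, h1, h2]
  simp only [koszul, real_inner_comm, FiberBundle.extend_apply_self]
  rw [VectorField.mlieBracket_swap_apply (V := Y) (W := X),
    VectorField.mlieBracket_swap_apply (V := FiberBundle.extend E w) (W := X),
    VectorField.mlieBracket_swap_apply (V := FiberBundle.extend E w) (W := Y)]
  simp only [inner_neg_right]
  ring

/-- The Levi-Civita connection is metric. -/
theorem leviCivita_metric {x : M} (v : TangentSpace I x) {Y Z : Π x : M, TangentSpace I x}
    (hY : MDiffAt (T% Y) x) (hZ : MDiffAt (T% Z) x) :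
    d% (fun y ↦ inner ℝ (Y y) (Z y)) x v
      = inner ℝ (leviCivita I M Y x v) (Z x) + inner ℝ (Y x) (leviCivita I M Z x v) := by
  have hv := FiberBundle.mdifferentiableAt_extend I E v
  have h1 := inner_leviCivita hv hY hZ
  have h2 := inner_leviCivita hv hZ hY
  rw [FiberBundle.extend_apply_self] at h1 h2
  rw [real_inner_comm _ (Y x), h1, h2]
  simp only [koszul, real_inner_comm, FiberBundle.extend_apply_self]
  rw [VectorField.mlieBracket_swap_apply (V := Z) (W := Y),
    VectorField.mlieBracket_swap_apply (V := Z),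
    VectorField.mlieBracket_swap_apply (V := Y) (W := FiberBundle.extend E v)]
  simp only [inner_neg_right]
  ring

end LeviCivita

noncomputable section AlmostContact

variable {E : Type*} [NormedAddCommGroup E] [NormedSpace ℝ E] [FiniteDimensional ℝ E]
  {H : Type*} [TopologicalSpace H] (I : ModelWithCorners ℝ E H)
  (M : Type*) [TopologicalSpace M] [ChartedSpace H M] [IsManifold I ∞ M]
  [RiemannianBundle (fun x : M ↦ TangentSpace I x)]
  [IsContMDiffRiemannianBundle I ∞ E (fun x : M ↦ TangentSpace I x)]

/-- An almost contact metric structure `(ξ, η, φ)` on a Riemannian manifold. The 1-form `η` is the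
metric dual of `ξ`, so it is not a separate field; see `AlmostContactMetric.eta`. -/
structure AlmostContactMetric where
  xi : Π x : M, TangentSpace I x
  phi : Π x : M, TangentSpace I x →L[ℝ] TangentSpace I x
  contMDiff_xi : CMDiff ∞ (T% xi)
  contMDiff_phi : ContMDiff I (I.prod 𝓘(ℝ, E →L[ℝ] E)) ∞
    (fun x ↦ TotalSpace.mk' (E →L[ℝ] E)
      (E := fun x : M ↦ TangentSpace I x →L[ℝ] TangentSpace I x) x (phi x))
  norm_xi : ∀ x, ‖xi x‖ = 1
  phi_xi : ∀ x, phi x (xi x) = 0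
  phi_phi : ∀ x (X : TangentSpace I x), phi x (phi x X) = -X + inner ℝ (xi x) X • xi x
  inner_phi_phi : ∀ x (X Y : TangentSpace I x),
    inner ℝ (phi x X) (phi x Y) = inner ℝ X Y - inner ℝ (xi x) X * inner ℝ (xi x) Y

namespace AlmostContactMetric

variable {I M} (S : AlmostContactMetric I M)

lemma mdifferentiableAt_xi (x : M) : MDiffAt (T% S.xi) x :=
  (S.contMDiff_xi x).mdifferentiableAt (by simp)

lemma mdifferentiableAt_phi {x : M} {Y : Π x : M, TangentSpace I x} (hY : MDiffAt (T% Y) x) :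
    MDiffAt (T% fun y ↦ S.phi y (Y y)) x :=
  MDifferentiableAt.clm_bundle_apply ((S.contMDiff_phi x).mdifferentiableAt (by simp)) hY

/-- The 1-form `η = g(ξ, ·)`. -/
def eta (x : M) : TangentSpace I x →L[ℝ] ℝ := innerSL ℝ (S.xi x)

@[simp] lemma eta_apply (x : M) (X : TangentSpace I x) : S.eta x X = inner ℝ (S.xi x) X := rfl

/-- The fundamental 2-form `Φ(X, Y) = g(X, φ Y)`. -/
def fundForm (x : M) (X Y : TangentSpace I x) : ℝ := inner ℝ X (S.phi x Y)

/-- `X ↦ X(η(Y)) - η(∇_X Y)` at `x`, for a vector field `Y`. -/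
def nablaEtaAux (Y : Π x : M, TangentSpace I x) (x : M) : TangentSpace I x →L[ℝ] ℝ :=
  d% (fun y ↦ S.eta y (Y y)) x - S.eta x ∘L leviCivita I M Y x

lemma nablaEtaAux_tensorial (x : M) : TensorialAt I E (fun Y ↦ S.nablaEtaAux Y x) x where
  smul {f Y} hf hY := by
    have h1 := mvfderiv_fun_mul hf (mdifferentiableAt_inner (S.mdifferentiableAt_xi x) hY)
    ext v
    simp [nablaEtaAux, h1,
      (leviCivita I M).isCovariantDerivativeOn.leibniz hY hf]
    ring
  add {Y Y'} hY hY' := by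
    have h1 := mvfderiv_fun_add (mdifferentiableAt_inner (S.mdifferentiableAt_xi x) hY)
      (mdifferentiableAt_inner (S.mdifferentiableAt_xi x) hY')
    ext v
    simp [nablaEtaAux, h1, inner_add_right,
      (leviCivita I M).isCovariantDerivativeOn.add hY hY']
    ring

/-- The covariant derivative of `η`: `S.nablaEta x Y X` is `(∇_X η)(Y)`. -/
def nablaEta (x : M) : TangentSpace I x →L[ℝ] TangentSpace I x →L[ℝ] ℝ :=
  TensorialAt.mkHom (fun Y ↦ S.nablaEtaAux Y x) x (S.nablaEtaAux_tensorial x)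

/-- The differential `dη = ∑ i, e i ∧ ∇_{e i} η`. -/
def dEta (x : M) (X Y : TangentSpace I x) : ℝ := S.nablaEta x Y X - S.nablaEta x X Y

/-- `X ↦ X(Φ(Y, Z)) - Φ(∇_X Y, Z) - Φ(Y, ∇_X Z)` at `x`, for vector fields `Y`, `Z`. -/
def nablaFundFormAux (Y Z : Π x : M, TangentSpace I x) (x : M) : TangentSpace I x →L[ℝ] ℝ :=
  d% (fun y ↦ S.fundForm y (Y y) (Z y)) x
    - (innerSL ℝ (S.phi x (Z x))) ∘L leviCivita I M Y x
    - (innerSL ℝ (Y x) ∘L S.phi x) ∘L leviCivita I M Z x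

lemma nablaFundFormAux_apply (Y Z : Π x : M, TangentSpace I x) (x : M) (X : TangentSpace I x) :
    S.nablaFundFormAux Y Z x X = d% (fun y ↦ S.fundForm y (Y y) (Z y)) x X
      - S.fundForm x (leviCivita I M Y x X) (Z x) - S.fundForm x (Y x) (leviCivita I M Z x X) := by
  simp [nablaFundFormAux, fundForm, real_inner_comm]

lemma nablaFundFormAux_tensorial_left {x : M} {Z : Π x : M, TangentSpace I x}
    (hZ : MDiffAt (T% Z) x) : TensorialAt I E (fun Y ↦ S.nablaFundFormAux Y Z x) x where
  smul {f Y} hf hY := by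
    have h1 := mvfderiv_fun_mul hf (mdifferentiableAt_inner hY (S.mdifferentiableAt_phi hZ))
    ext v
    simp [nablaFundFormAux_apply, fundForm, inner_smul_left, h1, inner_add_left,
      (leviCivita I M).isCovariantDerivativeOn.leibniz hY hf]
    ring
  add {Y Y'} hY hY' := by
    have h1 := mvfderiv_fun_add (mdifferentiableAt_inner hY (S.mdifferentiableAt_phi hZ))
      (mdifferentiableAt_inner hY' (S.mdifferentiableAt_phi hZ))
    ext v
    simp [nablaFundFormAux_apply, fundForm, h1, inner_add_left,
      (leviCivita I M).isCovariantDerivativeOn.add hY hY']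
    ring

lemma nablaFundFormAux_tensorial_right {x : M} {Y : Π x : M, TangentSpace I x}
    (hY : MDiffAt (T% Y) x) : TensorialAt I E (fun Z ↦ S.nablaFundFormAux Y Z x) x where
  smul {f Z} hf hZ := by
    have h1 := mvfderiv_fun_mul hf (mdifferentiableAt_inner hY (S.mdifferentiableAt_phi hZ))
    ext v
    simp [nablaFundFormAux_apply, fundForm, inner_smul_right, h1, inner_add_right,
      (leviCivita I M).isCovariantDerivativeOn.leibniz hZ hf]
    ring
  add {Z Z'} hZ hZ' := by
    have h1 := mvfderiv_fun_add (mdifferentiableAt_inner hY (S.mdifferentiableAt_phi hZ))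
      (mdifferentiableAt_inner hY (S.mdifferentiableAt_phi hZ'))
    ext v
    simp [nablaFundFormAux_apply, fundForm, h1, inner_add_right,
      (leviCivita I M).isCovariantDerivativeOn.add hZ hZ']
    ring

/-- The covariant derivative of `Φ`: `S.nablaFundForm x Y Z X` is `(∇_X Φ)(Y, Z)`. -/
def nablaFundForm (x : M) :
    TangentSpace I x →L[ℝ] TangentSpace I x →L[ℝ] TangentSpace I x →L[ℝ] ℝ :=
  TensorialAt.mkHom₂ (fun Y Z ↦ S.nablaFundFormAux Y Z x) x
    (fun _ hZ ↦ S.nablaFundFormAux_tensorial_left hZ)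
    (fun _ hY ↦ S.nablaFundFormAux_tensorial_right hY)

/-- The differential `dΦ = ∑ i, e i ∧ ∇_{e i} Φ`. -/
def dFundForm (x : M) (X Y Z : TangentSpace I x) : ℝ :=
  S.nablaFundForm x Y Z X - S.nablaFundForm x X Z Y + S.nablaFundForm x X Y Z

/-- The Nijenhuis torsion `[φ, φ](Y, Z)` of `φ` at `x`, for vector fields `Y`, `Z`. -/
def nijenhuisTorsionAux (Y Z : Π x : M, TangentSpace I x) (x : M) : TangentSpace I x :=
  VectorField.mlieBracket I (fun y ↦ S.phi y (Y y)) (fun y ↦ S.phi y (Z y)) x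
    + S.phi x (S.phi x (VectorField.mlieBracket I Y Z x))
    - S.phi x (VectorField.mlieBracket I (fun y ↦ S.phi y (Y y)) Z x)
    - S.phi x (VectorField.mlieBracket I Y (fun y ↦ S.phi y (Z y)) x)

lemma nijenhuisTorsionAux_tensorial_left {x : M} (Z : Π x : M, TangentSpace I x) :
    TensorialAt I E (fun Y ↦ S.nijenhuisTorsionAux Y Z x) x where
  smul {f Y} hf hY := by
    have h : (fun y ↦ S.phi y ((f • Y) y)) = f • (fun y ↦ S.phi y (Y y)) := by
      ext y; simp
    simp only [nijenhuisTorsionAux, h,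
      VectorField.mlieBracket_smul_left hf hY,
      VectorField.mlieBracket_smul_left hf (S.mdifferentiableAt_phi hY), map_add, map_smul]
    module
  add {Y Y'} hY hY' := by
    have h : (fun y ↦ S.phi y ((Y + Y') y))
        = (fun y ↦ S.phi y (Y y)) + (fun y ↦ S.phi y (Y' y)) := by
      ext y; simp
    simp only [nijenhuisTorsionAux, h,
      VectorField.mlieBracket_add_left hY hY', VectorField.mlieBracket_add_left
        (S.mdifferentiableAt_phi hY) (S.mdifferentiableAt_phi hY'), map_add]
    module

lemma nijenhuisTorsionAux_tensorial_right {x : M} (Y : Π x : M, TangentSpace I x) :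
    TensorialAt I E (fun Z ↦ S.nijenhuisTorsionAux Y Z x) x where
  smul {f Z} hf hZ := by
    have h : (fun y ↦ S.phi y ((f • Z) y)) = f • (fun y ↦ S.phi y (Z y)) := by
      ext y; simp
    simp only [nijenhuisTorsionAux, h,
      VectorField.mlieBracket_smul_right hf hZ,
      VectorField.mlieBracket_smul_right hf (S.mdifferentiableAt_phi hZ), map_add, map_smul]
    module
  add {Z Z'} hZ hZ' := by
    have h : (fun y ↦ S.phi y ((Z + Z') y))
        = (fun y ↦ S.phi y (Z y)) + (fun y ↦ S.phi y (Z' y)) := by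
      ext y; simp
    simp only [nijenhuisTorsionAux, h,
      VectorField.mlieBracket_add_right hZ hZ', VectorField.mlieBracket_add_right
        (S.mdifferentiableAt_phi hZ) (S.mdifferentiableAt_phi hZ'), map_add]
    module

/-- The Nijenhuis torsion `[φ, φ]` of `φ`. -/
def nijenhuisTorsion (x : M) :
    TangentSpace I x →L[ℝ] TangentSpace I x →L[ℝ] TangentSpace I x :=
  TensorialAt.mkHom₂ (fun Y Z ↦ S.nijenhuisTorsionAux Y Z x) x
    (fun Z _ ↦ S.nijenhuisTorsionAux_tensorial_left Z)
    (fun Y _ ↦ S.nijenhuisTorsionAux_tensorial_right Y)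

/-- The Nijenhuis tensor `N(X, Y, Z) = g(X, [φ, φ](Y, Z)) + η(X) dη(Y, Z)`. -/
def nijenhuis (x : M) (X Y Z : TangentSpace I x) : ℝ :=
  inner ℝ X (S.nijenhuisTorsion x Y Z) + S.eta x X * S.dEta x Y Z

/-- `ξ` is a Killing vector field: `g(∇_X ξ, Y) + g(∇_Y ξ, X) = 0`. -/
def IsKilling : Prop :=
  ∀ (x : M) (X Y : TangentSpace I x),
    inner ℝ (leviCivita I M S.xi x X) Y + inner ℝ (leviCivita I M S.xi x Y) X = 0

/-- Generalized quasi-Sasaki: `N` and `dΦ` vanish on the distribution orthogonal to `ξ`, and `ξ` is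
a Killing vector field. -/
structure IsGeneralizedQuasiSasaki : Prop where
  nijenhuis_eq_zero : ∀ (x : M) (X Y Z : TangentSpace I x),
    inner ℝ (S.xi x) X = 0 → inner ℝ (S.xi x) Y = 0 → inner ℝ (S.xi x) Z = 0 →
      S.nijenhuis x X Y Z = 0
  dFundForm_eq_zero : ∀ (x : M) (X Y Z : TangentSpace I x),
    inner ℝ (S.xi x) X = 0 → inner ℝ (S.xi x) Y = 0 → inner ℝ (S.xi x) Z = 0 →
      S.dFundForm x X Y Z = 0
  isKilling : S.IsKilling

/-- `γ(X, Y) = dΦ(ξ, φ X, Y)`. -/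
def gamma (x : M) (X Y : TangentSpace I x) : ℝ := S.dFundForm x (S.xi x) (S.phi x X) Y

/-- The tensor `A(X, Y, Z) = (((dη - γ) ∧ η)(X, Y, Z) - N(X, Y, Z)) / 2`. -/
def canonicalTensor (x : M) (X Y Z : TangentSpace I x) : ℝ :=
  (1 / 2) * ((S.dEta x X Y - S.gamma x X Y) * S.eta x Z
    + (S.dEta x Y Z - S.gamma x Y Z) * S.eta x X
    + (S.dEta x Z X - S.gamma x Z X) * S.eta x Y
    - S.nijenhuis x X Y Z)

set_option synthInstance.maxHeartbeats 200000 in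
set_option maxHeartbeats 1000000 in
/-- The endomorphism-valued 1-form with `g(S.canonicalOneForm x Y X, Z) = A(X, Y, Z)`. -/
def canonicalOneForm (x : M) :
    TangentSpace I x →L[ℝ] TangentSpace I x →L[ℝ] TangentSpace I x :=
  LinearMap.toContinuousBilinearMap <| LinearMap.mk₂ ℝ
    (fun Y X ↦ (InnerProductSpace.toDual ℝ (TangentSpace I x)).symm
      (LinearMap.toContinuousLinearMap
        { toFun := fun Z ↦ S.canonicalTensor x X Y Z
          map_add' := fun Z Z' ↦ by
            simp [canonicalTensor, nijenhuis, dEta, gamma, dFundForm, inner_add_right]; ring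
          map_smul' := fun c Z ↦ by
            simp [canonicalTensor, nijenhuis, dEta, gamma, dFundForm, inner_smul_right]; ring }))
    (fun Y Y' X ↦ by
      refine ext_inner_right ℝ fun Z ↦ ?_
      simp [canonicalTensor, nijenhuis, dEta, gamma, dFundForm, inner_add_right, inner_add_left]
      ring)
    (fun c Y X ↦ by
      refine ext_inner_right ℝ fun Z ↦ ?_
      simp [canonicalTensor, nijenhuis, dEta, gamma, dFundForm, inner_smul_right, inner_smul_left]
      ring)
    (fun Y X X' ↦ by
      refine ext_inner_right ℝ fun Z ↦ ?_
      simp [canonicalTensor, nijenhuis, dEta, gamma, dFundForm, inner_add_right, inner_add_left]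
      ring)
    (fun c Y X ↦ by
      refine ext_inner_right ℝ fun Z ↦ ?_
      simp [canonicalTensor, nijenhuis, dEta, gamma, dFundForm, inner_smul_left]
      ring)

lemma inner_canonicalOneForm (x : M) (X Y Z : TangentSpace I x) :
    inner ℝ (S.canonicalOneForm x Y X) Z = S.canonicalTensor x X Y Z := by
  simp [canonicalOneForm]

/-- The canonical connection `∇ᶜ`, given by `g(∇ᶜ_X Y, Z) = g(∇_X Y, Z) + A(X, Y, Z)`. -/
def canonicalConnection : CovariantDerivative I E (TangentSpace I : M → Type _) :=
  (leviCivita I M).addOneForm S.canonicalOneForm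

lemma inner_canonicalConnection (Y : Π x : M, TangentSpace I x) (x : M) (X Z : TangentSpace I x) :
    inner ℝ (S.canonicalConnection Y x X) Z
      = inner ℝ (leviCivita I M Y x X) Z + S.canonicalTensor x X (Y x) Z := by
  rw [← inner_canonicalOneForm, ← inner_add_left]
  rfl

/-- The torsion of `∇ᶜ` as a (3,0)-tensor, `T(X, Y, Z) = g(∇ᶜ_X Y - ∇ᶜ_Y X - [X, Y], Z)`. -/
def canonicalTorsion (x : M) (X Y Z : TangentSpace I x) : ℝ :=
  inner ℝ (S.canonicalConnection.torsion x X Y) Z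

end AlmostContactMetric

end AlmostContact

noncomputable section Model

/-! ### Linear algebra of `ℝ⁵` with its standard `U(2)`-structure

Indices `0, …, 4` correspond to `e₁, …, e₅`. A 2-form `β` is identified with the skew matrix
`β i j = β(e i, e j)`, a 3-form (more generally an element of `Λ¹ ⊗ Λ²`) with the family of
matrices `A i j k = A(e i, e j, e k)`. -/

namespace U2Model

/-- The space of (3,0)-tensors on `ℝ⁵`. -/
abbrev Tensor3 := Fin 5 → Matrix (Fin 5) (Fin 5) ℝ

/-- The Lie algebra `𝔰𝔬(5)`, identified with `Λ²`. -/
def so5 : Submodule ℝ (Matrix (Fin 5) (Fin 5) ℝ) where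
  carrier := {A | Aᵀ = -A}
  zero_mem' := by simp
  add_mem' {A B} hA hB := by
    simp only [Set.mem_ofPred_eq] at hA hB ⊢
    rw [Matrix.transpose_add, hA, hB, neg_add]
  smul_mem' c A hA := by
    simp only [Set.mem_ofPred_eq] at hA ⊢
    rw [Matrix.transpose_smul, hA, smul_neg]

/-- The fundamental form `Φ = e₁ ∧ e₂ + e₃ ∧ e₄`. -/
def Phi : Matrix (Fin 5) (Fin 5) ℝ :=
  !![ 0, 1,  0, 0, 0;
     -1, 0,  0, 0, 0;
      0, 0,  0, 1, 0;
      0, 0, -1, 0, 0;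
      0, 0,  0, 0, 0]

/-- The 1-form `η = e₅`. -/
def eta : Fin 5 → ℝ := Pi.single 4 1

/-- The sign of `(v 0, …, v 4)` as a permutation of `0, …, 4`, and `0` if it is none. -/
def leviCivitaSymbol (v : Fin 5 → Fin 5) : ℤ :=
  ∏ i, ∏ j ∈ Finset.Ioi i, (SignType.sign ((v j : ℤ) - (v i : ℤ)) : ℤ)

/-- The Hodge operator `∗ : Λ² → Λ³`, for which `∗(e₁ ∧ e₂) = e₃ ∧ e₄ ∧ e₅`. -/
def hodge : Matrix (Fin 5) (Fin 5) ℝ →ₗ[ℝ] Tensor3 where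
  toFun β i := Matrix.of fun j k ↦
    (1 / 2) * ∑ a, ∑ b, (leviCivitaSymbol ![a, b, i, j, k] : ℝ) * β a b
  map_add' β β' := by
    ext i j k
    simp [mul_add, Finset.sum_add_distrib]
  map_smul' c β := by
    ext i j k
    simp only [Matrix.of_apply, Matrix.smul_apply, smul_eq_mul, Pi.smul_apply, RingHom.id_apply,
      Finset.mul_sum]
    exact Finset.sum_congr rfl fun a _ ↦ Finset.sum_congr rfl fun b _ ↦ by ring

/-- `β ↦ η ∧ β` on 2-forms. -/
def etaWedge : Matrix (Fin 5) (Fin 5) ℝ →ₗ[ℝ] Tensor3 where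
  toFun β i := Matrix.of fun j k ↦ eta i * β j k - eta j * β i k + eta k * β i j
  map_add' β β' := by
    ext i j k
    simp only [Matrix.of_apply, Matrix.add_apply, Pi.add_apply]
    ring
  map_smul' c β := by
    ext i j k
    simp only [Matrix.of_apply, Matrix.smul_apply, smul_eq_mul, Pi.smul_apply, RingHom.id_apply]
    ring

/-- `β ↦ Φ ∧ β` on 2-forms. -/
def phiWedge : Matrix (Fin 5) (Fin 5) ℝ →ₗ[ℝ] (Fin 5 → Fin 5 → Fin 5 → Fin 5 → ℝ) where
  toFun β i j k l := Phi i j * β k l - Phi i k * β j l + Phi i l * β j k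
    + Phi j k * β i l - Phi j l * β i k + Phi k l * β i j
  map_add' β β' := by
    ext i j k l
    simp only [Matrix.add_apply, Pi.add_apply]
    ring
  map_smul' c β := by
    ext i j k l
    simp only [Matrix.smul_apply, smul_eq_mul, Pi.smul_apply, RingHom.id_apply]
    ring

/-- `Λ²₁ = ℝ Φ`. -/
def Lambda1 : Submodule ℝ (Matrix (Fin 5) (Fin 5) ℝ) := Submodule.span ℝ {Phi}

/-- `Λ²₂ = {β | Φ ∧ β = 0, ∗β = η ∧ β}`. -/
def Lambda2 : Submodule ℝ (Matrix (Fin 5) (Fin 5) ℝ) :=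
  so5 ⊓ LinearMap.ker phiWedge ⊓ LinearMap.eqLocus hodge etaWedge

/-- `Λ²₃ = {β | ∗β = -η ∧ β}`. -/
def Lambda3 : Submodule ℝ (Matrix (Fin 5) (Fin 5) ℝ) :=
  so5 ⊓ LinearMap.eqLocus hodge (-etaWedge)

/-- The Lie algebra `𝔲(2)`: the elements of `𝔰𝔬(5)` that annihilate `ξ = e₅` and commute with `φ`,
whose matrix is `Phi`. -/
def u2 : Submodule ℝ (Matrix (Fin 5) (Fin 5) ℝ) where
  carrier := {A | A ∈ so5 ∧ A * Phi = Phi * A ∧ A.mulVec eta = 0}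
  zero_mem' := by simp
  add_mem' {A B} hA hB :=
    ⟨so5.add_mem hA.1 hB.1, by rw [add_mul, mul_add, hA.2.1, hB.2.1],
      by rw [Matrix.add_mulVec, hA.2.2, hB.2.2, add_zero]⟩
  smul_mem' c A hA :=
    ⟨so5.smul_mem c hA.1, by rw [smul_mul_assoc, mul_smul_comm, hA.2.1],
      by rw [Matrix.smul_mulVec, hA.2.2, smul_zero]⟩

/-- The orthogonal projection of `ℝ⁵` onto the orthogonal complement of `e₅`. -/
def horizontal : Matrix (Fin 5) (Fin 5) ℝ := Matrix.diagonal ![1, 1, 1, 1, 0]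

/-- The orthogonal projection of `𝔰𝔬(5)` onto `𝔲(2)^⊥` with respect to the inner product
`⟨x, y⟩ = -(1/2) tr(x y)`; see `prU2Perp_mem`, `sub_prU2Perp_mem`, `prU2Perp_orthogonal`. -/
def prU2Perp : Matrix (Fin 5) (Fin 5) ℝ →ₗ[ℝ] Matrix (Fin 5) (Fin 5) ℝ where
  toFun A := A - (1 / 2 : ℝ) • (horizontal * A * horizontal - Phi * A * Phi)
  map_add' A B := by simp only [mul_add, add_mul]; module
  map_smul' c A := by simp only [mul_smul_comm, smul_mul_assoc, RingHom.id_apply]; module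

lemma transpose_Phi : Phiᵀ = -Phi := by
  ext i j; fin_cases i <;> fin_cases j <;> simp [Phi]

lemma transpose_horizontal : horizontalᵀ = horizontal := by simp [horizontal]

lemma horizontal_mul_Phi : horizontal * Phi = Phi := by
  ext i j; fin_cases i <;> fin_cases j <;> simp [Phi, horizontal]

lemma Phi_mul_horizontal : Phi * horizontal = Phi := by
  ext i j; fin_cases i <;> fin_cases j <;> simp [Phi, horizontal]

lemma Phi_mul_Phi : Phi * Phi = -horizontal := by
  ext i j
  fin_cases i <;> fin_cases j <;> simp [Phi, horizontal, Matrix.mul_apply, Fin.sum_univ_five]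

lemma horizontal_eq : horizontal = 1 - Matrix.vecMulVec eta eta := by
  ext i j
  fin_cases i <;> fin_cases j <;>
    simp [horizontal, eta, Matrix.vecMulVec, Pi.single_apply]

lemma prU2Perp_mem {A : Matrix (Fin 5) (Fin 5) ℝ} (hA : A ∈ so5) : prU2Perp A ∈ so5 := by
  change (A - (1 / 2 : ℝ) • (horizontal * A * horizontal - Phi * A * Phi))ᵀ = -_
  change Aᵀ = -A at hA
  simp only [Matrix.transpose_sub, Matrix.transpose_smul, Matrix.transpose_mul, hA, transpose_Phi,
    transpose_horizontal, prU2Perp, LinearMap.coe_mk, AddHom.coe_mk, mul_neg, neg_mul, mul_assoc]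
  module

lemma mul_horizontal_of_mem {B : Matrix (Fin 5) (Fin 5) ℝ} (hB : B ∈ u2) : B * horizontal = B := by
  rw [horizontal_eq, mul_sub, mul_one, Matrix.mul_vecMulVec, hB.2.2]
  simp

lemma horizontal_mul_of_mem {B : Matrix (Fin 5) (Fin 5) ℝ} (hB : B ∈ u2) : horizontal * B = B := by
  have h := congrArg Matrix.transpose (mul_horizontal_of_mem hB)
  have h1 : Bᵀ = -B := hB.1
  simpa [Matrix.transpose_mul, transpose_horizontal, h1] using h

lemma sub_prU2Perp_mem {A : Matrix (Fin 5) (Fin 5) ℝ} (hA : A ∈ so5) : A - prU2Perp A ∈ u2 := by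
  have h : A - prU2Perp A = (1 / 2 : ℝ) • (horizontal * A * horizontal - Phi * A * Phi) := by
    simp [prU2Perp]
  refine ⟨so5.sub_mem hA (prU2Perp_mem hA), ?_, ?_⟩
  · rw [h, smul_mul_assoc, mul_smul_comm, sub_mul, mul_sub]
    congr 1
    have e1 : horizontal * A * horizontal * Phi = horizontal * A * Phi := by
      rw [mul_assoc, horizontal_mul_Phi]
    have e2 : Phi * A * Phi * Phi = -(Phi * A * horizontal) := by
      rw [mul_assoc, Phi_mul_Phi, mul_neg]
    have e3 : Phi * (horizontal * A * horizontal) = Phi * A * horizontal := by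
      rw [← mul_assoc, ← mul_assoc, Phi_mul_horizontal]
    have e4 : Phi * (Phi * A * Phi) = -(horizontal * A * Phi) := by
      rw [← mul_assoc, ← mul_assoc, Phi_mul_Phi, neg_mul, neg_mul]
    rw [e1, e2, e3, e4]
    abel
  · have h1 : horizontal.mulVec eta = 0 := by
      ext i; fin_cases i <;> simp [horizontal, eta, Matrix.mulVec, dotProduct,
        Matrix.diagonal]
    have h2 : Phi.mulVec eta = 0 := by
      ext i; fin_cases i <;> simp [Phi, eta, Matrix.mulVec, dotProduct, Fin.sum_univ_five]
    rw [h, Matrix.smul_mulVec, Matrix.sub_mulVec, ← Matrix.mulVec_mulVec eta _ horizontal,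
      ← Matrix.mulVec_mulVec eta _ Phi, h1, h2]
    simp

lemma prU2Perp_orthogonal (A : Matrix (Fin 5) (Fin 5) ℝ) {B : Matrix (Fin 5) (Fin 5) ℝ}
    (hB : B ∈ u2) : -(1 / 2 : ℝ) * (prU2Perp A * B).trace = 0 := by
  have h1 : (horizontal * A * horizontal * B).trace = (A * B).trace := by
    rw [mul_assoc, horizontal_mul_of_mem hB, mul_assoc, Matrix.trace_mul_comm, mul_assoc,
      mul_horizontal_of_mem hB]
  have h2 : (Phi * A * Phi * B).trace = -(A * B).trace := by
    rw [mul_assoc, mul_assoc, Matrix.trace_mul_comm, mul_assoc, mul_assoc, hB.2.1, ← mul_assoc Phi,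
      Phi_mul_Phi, neg_mul, horizontal_mul_of_mem hB, mul_neg, Matrix.trace_neg]
  have h3 : (prU2Perp A * B).trace = (A * B).trace - (1 / 2) *
      ((horizontal * A * horizontal * B).trace - (Phi * A * Phi * B).trace) := by
    simp [prU2Perp, sub_mul, Matrix.trace_sub, Matrix.trace_smul]
  rw [h3, h1, h2]
  ring

/-- The projection `pr_𝒲(α ⊗ β) = α ⊗ pr_{𝔲(2)^⊥}(β)`. -/
def prW : Tensor3 →ₗ[ℝ] Tensor3 := LinearMap.pi fun i ↦ prU2Perp ∘ₗ LinearMap.proj i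

/-- `θ(β)(X, Y, Z) = ∗β(X, Y, Z)`. -/
def theta : Matrix (Fin 5) (Fin 5) ℝ →ₗ[ℝ] Tensor3 := hodge

/-- `ϑ(β)(X, Y, Z) = 3 η(X) β(Y, Z) - ∗β(X, Y, Z)`. -/
def vartheta : Matrix (Fin 5) (Fin 5) ℝ →ₗ[ℝ] Tensor3 :=
  LinearMap.pi (fun i ↦ (3 * eta i) • LinearMap.id) - hodge

/-- `𝒲₃ = pr_𝒲(θ(Λ²₁))`. -/
def W3 : Submodule ℝ Tensor3 := (Lambda1.map theta).map prW

/-- `𝒲₄ = pr_𝒲(θ(Λ²₂))`. -/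
def W4 : Submodule ℝ Tensor3 := (Lambda2.map theta).map prW

/-- `𝒲₅ = pr_𝒲(θ(Λ²₃))`. -/
def W5 : Submodule ℝ Tensor3 := (Lambda3.map theta).map prW

/-- `𝒲₇ = pr_𝒲(ϑ(Λ²₂))`. -/
def W7 : Submodule ℝ Tensor3 := (Lambda2.map vartheta).map prW

end U2Model

end Model

noncomputable section Classes

variable {M : Type*} [TopologicalSpace M] [ChartedSpace (EuclideanSpace ℝ (Fin 5)) M]
  [IsManifold (𝓡 5) ∞ M] [RiemannianBundle (fun x : M ↦ TangentSpace (𝓡 5) x)]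

/-- A (3,0)-tensor field `T` of the type of a torsion tensor is totally skew-symmetric. -/
def IsTotallySkewSymmetric
    (T : ∀ x : M, TangentSpace (𝓡 5) x → TangentSpace (𝓡 5) x → TangentSpace (𝓡 5) x → ℝ) : Prop :=
  ∀ x X Y Z, T x X Y Z + T x X Z Y = 0

/-- A (3,0)-tensor field `T` of the type of a torsion tensor is traceless cyclic. -/
def IsTracelessCyclic
    (T : ∀ x : M, TangentSpace (𝓡 5) x → TangentSpace (𝓡 5) x → TangentSpace (𝓡 5) x → ℝ) : Prop :=
  ∀ x, (∀ X Y Z, T x X Y Z + T x Y Z X + T x Z X Y = 0) ∧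
    ∀ (e : OrthonormalBasis (Fin 5) ℝ (TangentSpace (𝓡 5) x)) (X : TangentSpace (𝓡 5) x),
      ∑ i, T x X (e i) (e i) = 0

namespace AlmostContactMetric

variable (S : AlmostContactMetric (𝓡 5) M)

/-- An adapted frame of an almost contact metric 5-manifold, on an open neighbourhood of `x`. -/
structure AdaptedFrame (x : M) where
  domain : Set M
  isOpen_domain : IsOpen domain
  mem_domain : x ∈ domain
  e : Fin 5 → Π y : M, TangentSpace (𝓡 5) y
  contMDiffOn : ∀ i, ContMDiffOn (𝓡 5) (𝓡 5).tangent ∞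
    (fun y ↦ (⟨y, e i y⟩ : TangentBundle (𝓡 5) M)) domain
  orthonormal : ∀ y ∈ domain, Orthonormal ℝ fun i ↦ e i y
  fundForm_apply : ∀ y ∈ domain, ∀ i j, S.fundForm y (e i y) (e j y) = U2Model.Phi i j
  eta_apply : ∀ y ∈ domain, ∀ i, S.eta y (e i y) = U2Model.eta i

variable [IsContMDiffRiemannianBundle (𝓡 5) ∞ (EuclideanSpace ℝ (Fin 5))
  (fun x : M ↦ TangentSpace (𝓡 5) x)]
variable {S}

/-- The connection forms `ω i j (e k) = g(∇_{e k} e i, e j)` at `x` with respect to an adapted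
frame. -/
def AdaptedFrame.connectionForms {x : M} (F : S.AdaptedFrame x) : U2Model.Tensor3 :=
  fun k ↦ Matrix.of fun i j ↦ inner ℝ (leviCivita (𝓡 5) M (F.e i) x (F.e k x)) (F.e j x)

/-- The intrinsic torsion `Γ(X) = pr_{𝔲(2)^⊥}(Ω(X))` at `x` with respect to an adapted frame. -/
def AdaptedFrame.intrinsicTorsion {x : M} (F : S.AdaptedFrame x) : U2Model.Tensor3 :=
  U2Model.prW F.connectionForms

variable (S)

/-- The structure is of class `W` (a `U(2)`-submodule of `Λ¹ ⊗ 𝔲(2)^⊥`): the intrinsic torsion `Γ`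
lies in `W` at every point, with respect to the adapted frames. -/
def IsOfClass (W : Submodule ℝ U2Model.Tensor3) : Prop :=
  ∀ (x : M) (F : S.AdaptedFrame x), F.intrinsicTorsion ∈ W

end AlmostContactMetric

end Classes

noncomputable section

namespace U2Model

/-- The endomorphism `φ` maps `e j` to `phiSgn j • e (phiIdx j)`. -/
def phiIdx : Fin 5 → Fin 5 := ![1, 0, 3, 2, 4]

/-- The endomorphism `φ` maps `e j` to `phiSgn j • e (phiIdx j)`. -/
def phiSgn : Fin 5 → ℝ := ![-1, 1, -1, 1, 0]

lemma Phi_apply (i j : Fin 5) : Phi i j = if i = phiIdx j then phiSgn j else 0 := by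
  fin_cases i <;> fin_cases j <;> simp [Phi, phiIdx, phiSgn]

lemma Phi_apply_left (i j : Fin 5) : Phi i j = if j = phiIdx i then -phiSgn i else 0 := by
  fin_cases i <;> fin_cases j <;> simp [Phi, phiIdx, phiSgn]

lemma eta_apply_eq (i : Fin 5) : eta i = if i = 4 then 1 else 0 := by
  fin_cases i <;> simp [eta]

lemma prU2Perp_apply (A : Matrix (Fin 5) (Fin 5) ℝ) (i j : Fin 5) :
    prU2Perp A i j = A i j - (1 / 2) * (phiSgn i ^ 2 * phiSgn j ^ 2 * A i j
      + phiSgn i * phiSgn j * A (phiIdx i) (phiIdx j)) := by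
  have h1 : (horizontal * A * horizontal) i j = phiSgn i ^ 2 * phiSgn j ^ 2 * A i j := by
    rw [show horizontal = Matrix.diagonal fun k ↦ phiSgn k ^ 2 by
      rw [horizontal]; congr 1; ext k; fin_cases k <;> simp [phiSgn]]
    rw [Matrix.mul_diagonal, Matrix.diagonal_mul]
    ring
  have h2 : (Phi * A * Phi) i j = -(phiSgn i * phiSgn j * A (phiIdx i) (phiIdx j)) := by
    have h3 (B : Matrix (Fin 5) (Fin 5) ℝ) (k : Fin 5) :
        (Phi * B) i k = -phiSgn i * B (phiIdx i) k := by
      simp [Matrix.mul_apply, Phi_apply_left]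
    rw [Matrix.mul_assoc, h3]
    simp only [Matrix.mul_apply, Phi_apply, mul_ite, mul_zero, Finset.sum_ite_eq',
      Finset.mem_univ, if_true]
    ring
  change A i j - (1 / 2 : ℝ) * ((horizontal * A * horizontal) i j - (Phi * A * Phi) i j) = _
  rw [h1, h2]
  ring

lemma prU2Perp_of_mem_u2 {A : Matrix (Fin 5) (Fin 5) ℝ} (hA : A ∈ u2) : prU2Perp A = 0 := by
  change A - (1 / 2 : ℝ) • (horizontal * A * horizontal - Phi * A * Phi) = 0
  rw [horizontal_mul_of_mem hA, mul_horizontal_of_mem hA, mul_assoc, hA.2.1, ← mul_assoc,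
    Phi_mul_Phi, neg_mul, horizontal_mul_of_mem hA]
  module

lemma prU2Perp_prU2Perp {A : Matrix (Fin 5) (Fin 5) ℝ} (hA : A ∈ so5) :
    prU2Perp (prU2Perp A) = prU2Perp A := by
  have h := prU2Perp_of_mem_u2 (sub_prU2Perp_mem hA)
  rw [map_sub, sub_eq_zero] at h
  exact h.symm

lemma mem_so5_iff {A : Matrix (Fin 5) (Fin 5) ℝ} : A ∈ so5 ↔ ∀ i j, A i j = -A j i := by
  change Aᵀ = -A ↔ _
  rw [← Matrix.ext_iff]
  exact ⟨fun h i j ↦ h j i, fun h i j ↦ h j i⟩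

/-- The 2-forms `β` with `ξ ⌟ β = 0`. -/
def horizontalForms : Submodule ℝ (Matrix (Fin 5) (Fin 5) ℝ) where
  carrier := {β | β ∈ so5 ∧ ∀ i, β i 4 = 0}
  zero_mem' := by simp
  add_mem' hA hB := ⟨so5.add_mem hA.1 hB.1, fun i ↦ by simp [hA.2 i, hB.2 i]⟩
  smul_mem' c A hA := ⟨so5.smul_mem c hA.1, fun i ↦ by simp [hA.2 i]⟩

lemma apply_four_of_mem {β : Matrix (Fin 5) (Fin 5) ℝ} (hβ : β ∈ horizontalForms) (i : Fin 5) :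
    β 4 i = 0 := by
  rw [mem_so5_iff.1 hβ.1 4 i, hβ.2 i, neg_zero]

lemma prU2Perp_mem_horizontalForms {β : Matrix (Fin 5) (Fin 5) ℝ} (hβ : β ∈ horizontalForms) :
    prU2Perp β ∈ horizontalForms :=
  ⟨prU2Perp_mem hβ.1, fun i ↦ by simp [prU2Perp_apply, hβ.2 i, phiSgn]⟩

lemma leviCivitaSymbol_eq_eta_wedge : ∀ a b i j k : Fin 5, a ≠ 4 → b ≠ 4 →
    leviCivitaSymbol ![a, b, i, j, k] =
      (if i = 4 then 1 else 0) * leviCivitaSymbol ![a, b, 4, j, k]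
      - (if j = 4 then 1 else 0) * leviCivitaSymbol ![a, b, 4, i, k]
      + (if k = 4 then 1 else 0) * leviCivitaSymbol ![a, b, 4, i, j] := by
  decide +kernel

lemma hodge_eq_etaWedge {β : Matrix (Fin 5) (Fin 5) ℝ} (hβ : β ∈ horizontalForms) :
    hodge β = etaWedge (hodge β 4) := by
  ext i j k
  change (1 / 2 : ℝ) * ∑ a, ∑ b, (leviCivitaSymbol ![a, b, i, j, k] : ℝ) * β a b =
    eta i * ((1 / 2 : ℝ) * ∑ a, ∑ b, (leviCivitaSymbol ![a, b, 4, j, k] : ℝ) * β a b)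
    - eta j * ((1 / 2 : ℝ) * ∑ a, ∑ b, (leviCivitaSymbol ![a, b, 4, i, k] : ℝ) * β a b)
    + eta k * ((1 / 2 : ℝ) * ∑ a, ∑ b, (leviCivitaSymbol ![a, b, 4, i, j] : ℝ) * β a b)
  simp only [Finset.mul_sum, ← Finset.sum_sub_distrib, ← Finset.sum_add_distrib]
  refine Finset.sum_congr rfl fun a _ ↦ Finset.sum_congr rfl fun b _ ↦ ?_
  by_cases ha : a = 4
  · simp [ha, apply_four_of_mem hβ]
  by_cases hb : b = 4
  · simp [hb, hβ.2]
  rw [leviCivitaSymbol_eq_eta_wedge a b i j k ha hb]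
  simp only [eta_apply_eq]
  push_cast
  ring

/-- The components of `e c ∧ e d`. -/
def eps (a b c d : Fin 5) : ℤ :=
  (if a = c ∧ b = d then 1 else 0) - (if a = d ∧ b = c then 1 else 0)

/-- `ξ ⌟ ∗β` is the image of `β` under the Hodge operator of `ℝ⁴`. -/
lemma hodge_four_apply {β : Matrix (Fin 5) (Fin 5) ℝ} (hβ : β ∈ so5) :
    hodge β 4 = !![0, β 2 3, -β 1 3, β 1 2, 0;
      -β 2 3, 0, β 0 3, -β 0 2, 0;
      β 1 3, -β 0 3, 0, β 0 1, 0;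
      -β 1 2, β 0 2, -β 0 1, 0, 0;
      0, 0, 0, 0, 0] := by
  have h := mem_so5_iff.1 hβ
  have key : ∀ a b j k : Fin 5, leviCivitaSymbol ![a, b, 4, j, k] =
      (![![0, eps a b 2 3, eps a b 3 1, eps a b 1 2, 0],
        ![eps a b 3 2, 0, eps a b 0 3, eps a b 2 0, 0],
        ![eps a b 1 3, eps a b 3 0, 0, eps a b 0 1, 0],
        ![eps a b 2 1, eps a b 0 2, eps a b 1 0, 0, 0],
        ![0, 0, 0, 0, 0]] : Fin 5 → Fin 5 → ℤ) j k := by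
    decide +kernel
  have key' (c d : Fin 5) : ∑ a, ∑ b, (eps a b c d : ℝ) * β a b = 2 * β c d := by
    simp only [eps]
    push_cast
    simp only [sub_mul, Finset.sum_sub_distrib, ite_mul, one_mul, zero_mul, ite_and,
      Finset.sum_ite_irrel, Finset.sum_const_zero, Finset.sum_ite_eq', Finset.mem_univ, if_true]
    rw [h d c]; ring
  ext j k
  change (1 / 2 : ℝ) * ∑ a, ∑ b, (leviCivitaSymbol ![a, b, 4, j, k] : ℝ) * β a b = _
  simp only [key]
  fin_cases j <;> fin_cases k <;> simp [key'] <;> linarith [h 3 1, h 3 2, h 2 1, h 3 0, h 2 0, h 1 0]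

end U2Model
end

noncomputable section

namespace U2Model

/-- The tensor with `ξ`-part `η ⊗ M` and mixed part determined by `g(Γ(X) Y, ξ) = B(X, Y)`. -/
def mixedTensor (B M : Matrix (Fin 5) (Fin 5) ℝ) : Tensor3 := fun k ↦
  Matrix.of fun i j ↦ eta k * M i j + eta j * B k i - eta i * B k j

lemma etaWedge_eq_mixedTensor {β : Matrix (Fin 5) (Fin 5) ℝ} : etaWedge β = mixedTensor β β := by
  ext i j k
  change eta i * β j k - eta j * β i k + eta k * β i j = _
  simp only [mixedTensor, Matrix.of_apply]
  ring

lemma prW_mixedTensor (B M : Matrix (Fin 5) (Fin 5) ℝ) :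
    prW (mixedTensor B M) = mixedTensor B (prU2Perp M) := by
  ext k i j
  change prU2Perp (mixedTensor B M k) i j = _
  have h1 (i : Fin 5) : phiSgn i * eta i = 0 := by fin_cases i <;> simp [phiSgn, eta]
  have h2 (i : Fin 5) : phiSgn i * eta (phiIdx i) = 0 := by
    fin_cases i <;> simp [phiSgn, phiIdx, eta]
  simp only [mixedTensor, Matrix.of_apply, prU2Perp_apply]
  linear_combination (-(1 / 2) * phiSgn i ^ 2 * B k i * phiSgn j) * h1 j
    + ((1 / 2) * phiSgn j ^ 2 * B k j * phiSgn i) * h1 i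
    - (1 / 2) * phiSgn i * B k (phiIdx i) * h2 j + (1 / 2) * phiSgn j * B k (phiIdx j) * h2 i

lemma mixedTensor_four (B M : Matrix (Fin 5) (Fin 5) ℝ) (hB : ∀ i, B 4 i = 0) :
    mixedTensor B M 4 = M := by
  ext i j
  simp [mixedTensor, hB, eta]

lemma mixedTensor_inj {B B' M M' : Matrix (Fin 5) (Fin 5) ℝ} (hB : B ∈ horizontalForms)
    (hB' : B' ∈ horizontalForms) (h : mixedTensor B M = mixedTensor B' M') : B = B' ∧ M = M' := by
  have hM : M = M' := by
    rw [← mixedTensor_four B M (apply_four_of_mem hB), h,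
      mixedTensor_four _ _ (apply_four_of_mem hB')]
  refine ⟨?_, hM⟩
  ext k i
  have h1 := congrFun (congrFun (congrFun h k) i) 4
  rw [hM] at h1
  simp only [mixedTensor, Matrix.of_apply, hB.2, hB'.2] at h1
  simpa [eta] using h1

lemma Phi_mem_horizontalForms : Phi ∈ horizontalForms := by
  refine ⟨transpose_Phi, fun i ↦ ?_⟩
  fin_cases i <;> simp [Phi]

lemma mem_horizontalForms_of_hodge {β : Matrix (Fin 5) (Fin 5) ℝ} (hβ : β ∈ so5) {c : ℝ}
    (h : hodge β = c • etaWedge β) : β ∈ horizontalForms ∧ hodge β 4 = c • β := by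
  have hs := mem_so5_iff.1 hβ
  have key : ∀ a b i j k : Fin 5, i ≠ 4 → j ≠ 4 → k ≠ 4 →
    leviCivitaSymbol ![a, b, i, j, k] =
      leviCivitaSymbol ![i, j, k, a, 4] * ((if b = 4 then 1 else 0))
        - leviCivitaSymbol ![i, j, k, b, 4] * ((if a = 4 then 1 else 0)) := by
    decide +kernel
  have h4 (i j k l : Fin 5) (hi : i ≠ 4) (hj : j ≠ 4) (hk : k ≠ 4) (hl : ∀ a,
      leviCivitaSymbol ![i, j, k, a, 4] = if a = l then 1 else 0) : β l 4 = 0 := by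
    have h1 := congrFun (congrFun (congrFun h i) j) k
    have h2 : (c • etaWedge β) i j k = 0 := by
      change c * (eta i * β j k - eta j * β i k + eta k * β i j) = 0
      simp [eta_apply_eq, hi, hj, hk]
    rw [h2] at h1
    change (1 / 2 : ℝ) * ∑ a, ∑ b, (leviCivitaSymbol ![a, b, i, j, k] : ℝ) * β a b = 0 at h1
    simp only [key _ _ i j k hi hj hk, hl] at h1
    push_cast at h1
    simp only [sub_mul, Finset.sum_sub_distrib, ite_mul, one_mul, zero_mul, mul_ite, mul_one,
      mul_zero, Finset.sum_ite_irrel, Finset.sum_const_zero, Finset.sum_ite_eq', Finset.mem_univ,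
      if_true] at h1
    linarith [hs 4 l]
  have hβ' : β ∈ horizontalForms := by
    refine ⟨hβ, fun i ↦ ?_⟩
    fin_cases i
    · exact h4 1 3 2 0 (by decide) (by decide) (by decide) (by decide)
    · exact h4 0 2 3 1 (by decide) (by decide) (by decide) (by decide)
    · exact h4 0 3 1 2 (by decide) (by decide) (by decide) (by decide)
    · exact h4 0 1 2 3 (by decide) (by decide) (by decide) (by decide)
    · change β 4 4 = 0
      linarith [hs 4 4]
  refine ⟨hβ', ?_⟩
  rw [h, etaWedge_eq_mixedTensor, Pi.smul_apply, mixedTensor_four _ _ (apply_four_of_mem hβ')]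

lemma hodge_eq_smul_of_four {β : Matrix (Fin 5) (Fin 5) ℝ} (hβ : β ∈ horizontalForms) {c : ℝ}
    (h : hodge β 4 = c • β) : hodge β = c • etaWedge β := by
  rw [hodge_eq_etaWedge hβ, h, map_smul]

lemma phiWedge_eq_zero_of_anticommute (x y : ℝ) :
    phiWedge !![0, 0, x, y, 0; 0, 0, y, -x, 0; -x, -y, 0, 0, 0; -y, x, 0, 0, 0; 0, 0, 0, 0, 0] = 0 := by
  let P : Fin 5 → Fin 5 → ℤ := ![![0, 1, 0, 0, 0], ![-1, 0, 0, 0, 0], ![0, 0, 0, 1, 0],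
    ![0, 0, -1, 0, 0], ![0, 0, 0, 0, 0]]
  let X : Fin 5 → Fin 5 → ℤ := ![![0, 0, 1, 0, 0], ![0, 0, 0, -1, 0], ![-1, 0, 0, 0, 0],
    ![0, 1, 0, 0, 0], ![0, 0, 0, 0, 0]]
  let Y : Fin 5 → Fin 5 → ℤ := ![![0, 0, 0, 1, 0], ![0, 0, 1, 0, 0], ![0, -1, 0, 0, 0],
    ![-1, 0, 0, 0, 0], ![0, 0, 0, 0, 0]]
  have hP (i j : Fin 5) : Phi i j = P i j := by
    fin_cases i <;> fin_cases j <;> simp [Phi, P]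
  have hX : !![0, 0, x, y, 0; 0, 0, y, -x, 0; -x, -y, 0, 0, 0; -y, x, 0, 0, 0; 0, 0, 0, 0, 0] =
      x • (Matrix.of fun i j ↦ (X i j : ℝ)) + y • (Matrix.of fun i j ↦ (Y i j : ℝ)) := by
    ext i j
    fin_cases i <;> fin_cases j <;> simp [X, Y]
  have h (Z : Fin 5 → Fin 5 → ℤ) (hZ : ∀ i j k l, P i j * Z k l - P i k * Z j l + P i l * Z j k
      + P j k * Z i l - P j l * Z i k + P k l * Z i j = 0) :
      phiWedge (Matrix.of fun i j ↦ (Z i j : ℝ)) = 0 := by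
    ext i j k l
    change Phi i j * (Z k l : ℝ) - Phi i k * (Z j l : ℝ) + Phi i l * (Z j k : ℝ)
      + Phi j k * (Z i l : ℝ) - Phi j l * (Z i k : ℝ) + Phi k l * (Z i j : ℝ) = 0
    simp only [hP]
    exact_mod_cast hZ i j k l
  rw [hX, map_add, map_smul, map_smul, h X (by decide +kernel), h Y (by decide +kernel)]
  simp

lemma mem_Lambda2_iff {β : Matrix (Fin 5) (Fin 5) ℝ} :
    β ∈ Lambda2 ↔ β ∈ horizontalForms ∧ prU2Perp β = β := by
  constructor
  · rintro ⟨⟨h1, h2⟩, h3⟩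
    have h3' : hodge β = (1 : ℝ) • etaWedge β := by rw [one_smul]; exact h3
    obtain ⟨h4, h5⟩ := mem_horizontalForms_of_hodge h1 h3'
    refine ⟨h4, ?_⟩
    have hs := mem_so5_iff.1 h1
    rw [hodge_four_apply h1, one_smul] at h5
    have e1 : β 2 3 = β 0 1 := by simpa using congrFun (congrFun h5 0) 1
    have e2 : -β 1 3 = β 0 2 := by simpa using congrFun (congrFun h5 0) 2
    have e3 : β 1 2 = β 0 3 := by simpa using congrFun (congrFun h5 0) 3
    have e4 : phiWedge β 0 1 2 3 = 0 := by rw [LinearMap.mem_ker.1 h2]; rfl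
    change Phi 0 1 * β 2 3 - Phi 0 2 * β 1 3 + Phi 0 3 * β 1 2
      + Phi 1 2 * β 0 3 - Phi 1 3 * β 0 2 + Phi 2 3 * β 0 1 = 0 at e4
    simp [Phi] at e4
    ext i j
    rw [prU2Perp_apply]
    fin_cases i <;> fin_cases j <;> simp [phiIdx, phiSgn] <;>
      linarith [hs 0 0, hs 1 1, hs 2 2, hs 3 3, hs 1 0, hs 2 0, hs 3 0, hs 2 1, hs 3 1, hs 3 2]
  · rintro ⟨h1, h2⟩
    have hs := mem_so5_iff.1 h1.1
    have hd (i : Fin 5) : β i i = 0 := by linarith [hs i i]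
    have h4 := h1.2
    have h4' := apply_four_of_mem h1
    have e (i j : Fin 5) := congrFun (congrFun h2 i) j
    simp only [prU2Perp_apply] at e
    have e01 := e 0 1
    have e02 := e 0 2
    have e03 := e 0 3
    have e23 := e 2 3
    simp [phiIdx, phiSgn] at e01 e02 e03 e23
    have hβ : β = !![0, 0, β 0 2, β 0 3, 0; 0, 0, β 0 3, -β 0 2, 0; -β 0 2, -β 0 3, 0, 0, 0;
        -β 0 3, β 0 2, 0, 0, 0; 0, 0, 0, 0, 0] := by
      ext i j
      fin_cases i <;> fin_cases j <;> simp [hd, h4, h4'] <;>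
        linarith [hs 1 0, hs 2 0, hs 3 0, hs 2 1, hs 3 1, hs 3 2]
    refine ⟨⟨h1.1, ?_⟩, ?_⟩
    · rw [SetLike.mem_coe, LinearMap.mem_ker, hβ]
      exact phiWedge_eq_zero_of_anticommute _ _
    · have := hodge_eq_smul_of_four h1 (c := 1) (by
        rw [hodge_four_apply h1.1, one_smul]
        ext i j
        fin_cases i <;> fin_cases j <;> simp [hd, h4, h4'] <;>
          linarith [hs 1 0, hs 2 0, hs 3 0, hs 2 1, hs 3 1, hs 3 2])
      rwa [one_smul] at this

lemma mem_Lambda3_iff {β : Matrix (Fin 5) (Fin 5) ℝ} :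
    β ∈ Lambda3 ↔ β ∈ horizontalForms ∧ hodge β 4 = -β := by
  constructor
  · rintro ⟨h1, h2⟩
    have h3 : hodge β = (-1 : ℝ) • etaWedge β := by rw [neg_one_smul]; exact h2
    have := mem_horizontalForms_of_hodge h1 h3
    rwa [neg_one_smul] at this
  · rintro ⟨h1, h2⟩
    refine ⟨h1.1, ?_⟩
    have := hodge_eq_smul_of_four h1 (c := -1) (by rwa [neg_one_smul])
    rwa [neg_one_smul] at this

lemma Lambda_sup : Lambda1 ⊔ Lambda2 ⊔ Lambda3 = horizontalForms := by
  apply le_antisymm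
  · refine sup_le (sup_le ?_ fun β hβ ↦ (mem_Lambda2_iff.1 hβ).1) fun β hβ ↦ (mem_Lambda3_iff.1 hβ).1
    rw [Lambda1, Submodule.span_le, Set.singleton_subset_iff]
    exact Phi_mem_horizontalForms
  · intro β hβ
    have hs := mem_so5_iff.1 hβ.1
    have hd (i : Fin 5) : β i i = 0 := by linarith [hs i i]
    have h4 := hβ.2
    have h4' := apply_four_of_mem hβ
    have hP := prU2Perp_mem_horizontalForms hβ
    have hc : ((β 0 1 + β 2 3) / 2) • Phi ∈ Lambda1 :=
      Submodule.smul_mem _ _ (Submodule.mem_span_singleton_self _)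
    have h2 : prU2Perp β ∈ Lambda2 := mem_Lambda2_iff.2 ⟨hP, prU2Perp_prU2Perp hβ.1⟩
    have h3 : β - prU2Perp β - ((β 0 1 + β 2 3) / 2) • Phi ∈ Lambda3 := by
      have hm : β - prU2Perp β - ((β 0 1 + β 2 3) / 2) • Phi ∈ horizontalForms :=
        Submodule.sub_mem _ (Submodule.sub_mem _ hβ hP)
          (Submodule.smul_mem _ _ Phi_mem_horizontalForms)
      refine mem_Lambda3_iff.2 ⟨hm, ?_⟩
      rw [hodge_four_apply hm.1]
      simp only [Matrix.sub_apply, Matrix.smul_apply, prU2Perp_apply, smul_eq_mul]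
      ext i j
      fin_cases i <;> fin_cases j <;> simp [hd, h4, h4', phiIdx, phiSgn, Phi, prU2Perp_apply] <;>
        linarith [hs 1 0, hs 2 0, hs 3 0, hs 2 1, hs 3 1, hs 3 2]
    have := Submodule.add_mem_sup (Submodule.add_mem_sup hc h2) h3
    convert this using 1
    abel

lemma mem_W3_sup_W4_sup_W5_iff {B M : Matrix (Fin 5) (Fin 5) ℝ} (hB : B ∈ horizontalForms) :
    mixedTensor B M ∈ W3 ⊔ W4 ⊔ W5 ↔ M = prU2Perp B := by
  have hstar {β : Matrix (Fin 5) (Fin 5) ℝ} (hβ : β ∈ horizontalForms) :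
      hodge β 4 ∈ horizontalForms ∧ hodge (hodge β 4) 4 = β := by
    have hs := mem_so5_iff.1 hβ.1
    have hd (i : Fin 5) : β i i = 0 := by linarith [hs i i]
    have h4 := hβ.2
    have h4' := apply_four_of_mem hβ
    have h1 : hodge β 4 ∈ so5 := by
      rw [mem_so5_iff, hodge_four_apply hβ.1]
      intro i j
      fin_cases i <;> fin_cases j <;> simp
    refine ⟨⟨h1, fun i ↦ ?_⟩, ?_⟩
    · rw [hodge_four_apply hβ.1]
      fin_cases i <;> simp
    · rw [hodge_four_apply h1, hodge_four_apply hβ.1]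
      ext i j
      fin_cases i <;> fin_cases j <;> simp [hd, h4, h4'] <;>
        linarith [hs 1 0, hs 2 0, hs 3 0, hs 2 1, hs 3 1, hs 3 2]
  rw [W3, W4, W5, ← Submodule.map_sup, ← Submodule.map_sup, ← Submodule.map_sup,
    ← Submodule.map_sup, Lambda_sup]
  have hθ {β : Matrix (Fin 5) (Fin 5) ℝ} (hβ : β ∈ horizontalForms) :
      prW (theta β) = mixedTensor (hodge β 4) (prU2Perp (hodge β 4)) := by
    rw [theta, hodge_eq_etaWedge hβ, etaWedge_eq_mixedTensor,
      mixedTensor_four _ _ (apply_four_of_mem (hstar hβ).1), prW_mixedTensor]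
  constructor
  · rintro ⟨_, ⟨β, hβ, rfl⟩, h⟩
    rw [hθ hβ] at h
    obtain ⟨h1, h2⟩ := mixedTensor_inj (hstar hβ).1 hB h
    rw [← h1, ← h2]
  · rintro rfl
    refine ⟨_, ⟨hodge B 4, (hstar hB).1, rfl⟩, ?_⟩
    rw [hθ (hstar hB).1, (hstar hB).2]

lemma mem_W7_iff {B M : Matrix (Fin 5) (Fin 5) ℝ} (hB : B ∈ horizontalForms) :
    mixedTensor B M ∈ W7 ↔ prU2Perp B = B ∧ M = -(2 : ℝ) • B := by
  have hϑ {β : Matrix (Fin 5) (Fin 5) ℝ} (hβ : β ∈ Lambda2) :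
      prW (vartheta β) = mixedTensor (-β) ((2 : ℝ) • β) := by
    have h : vartheta β = mixedTensor (-β) ((2 : ℝ) • β) := by
      have h1 : hodge β = mixedTensor β β := by
        rw [← etaWedge_eq_mixedTensor]
        exact hβ.2
      ext i j k
      change 3 * eta i * β j k - hodge β i j k = _
      rw [h1]
      simp only [mixedTensor, Matrix.of_apply, Matrix.neg_apply, Matrix.smul_apply, smul_eq_mul]
      ring
    rw [h, prW_mixedTensor, map_smul, (mem_Lambda2_iff.1 hβ).2]
  constructor
  · rintro ⟨_, ⟨β, hβ, rfl⟩, h⟩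
    rw [hϑ hβ] at h
    have hβ' := mem_Lambda2_iff.1 hβ
    obtain ⟨h1, h2⟩ := mixedTensor_inj (Submodule.neg_mem _ hβ'.1) hB h
    rw [← h1, ← h2, map_neg, hβ'.2]
    simp
  · rintro ⟨h1, rfl⟩
    refine ⟨_, ⟨-B, Submodule.neg_mem _ (mem_Lambda2_iff.2 ⟨hB, h1⟩), rfl⟩, ?_⟩
    rw [hϑ (Submodule.neg_mem _ (mem_Lambda2_iff.2 ⟨hB, h1⟩))]
    simp

end U2Model
end

noncomputable section

namespace U2Model

/-- The components `dη(e i, e j)` in terms of the connection forms `w`. -/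
def dEtaCoeff (w : Tensor3) (i j : Fin 5) : ℝ := w j i 4 - w i j 4

/-- The components `(∇_{e k} Φ)(e i, e j)` in terms of the connection forms `w`. -/
def nablaFundCoeff (w : Tensor3) (k i j : Fin 5) : ℝ :=
  phiSgn i * w k j (phiIdx i) - phiSgn j * w k i (phiIdx j)

/-- The components `dΦ(e i, e j, e k)` in terms of the connection forms `w`. -/
def dFundCoeff (w : Tensor3) (i j k : Fin 5) : ℝ :=
  nablaFundCoeff w i j k - nablaFundCoeff w j i k + nablaFundCoeff w k i j

/-- The components `g([e i, e j], e k)` in terms of the connection forms `w`. -/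
def bracketCoeff (w : Tensor3) (i j k : Fin 5) : ℝ := w i j k - w j i k

/-- The components `N(e i, e j, e k)` in terms of the connection forms `w`. -/
def nijenhuisCoeff (w : Tensor3) (i j k : Fin 5) : ℝ :=
  phiSgn j * phiSgn k * bracketCoeff w (phiIdx j) (phiIdx k) i
    - phiSgn i ^ 2 * bracketCoeff w j k i
    + phiSgn i * phiSgn j * bracketCoeff w (phiIdx j) k (phiIdx i)
    + phiSgn i * phiSgn k * bracketCoeff w j (phiIdx k) (phiIdx i)
    + eta i * dEtaCoeff w j k

/-- The components of the tensor `A = ((dη - γ) ∧ η - N) / 2` in terms of the connection forms. -/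
def canonicalCoeff (w : Tensor3) (i j k : Fin 5) : ℝ :=
  (1 / 2) * ((dEtaCoeff w i j - phiSgn i * dFundCoeff w 4 (phiIdx i) j) * eta k
    + (dEtaCoeff w j k - phiSgn j * dFundCoeff w 4 (phiIdx j) k) * eta i
    + (dEtaCoeff w k i - phiSgn k * dFundCoeff w 4 (phiIdx k) i) * eta j
    - nijenhuisCoeff w i j k)

/-- The components of the torsion of the canonical connection in terms of the connection forms. -/
def torsionCoeff (w : Tensor3) (i j k : Fin 5) : ℝ :=
  canonicalCoeff w i j k - canonicalCoeff w j i k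

/-- The conditions on the connection forms of an adapted frame of a generalized quasi-Sasaki
manifold. -/
structure IsQuasiSasakiForms (w : Tensor3) : Prop where
  skew : ∀ k i j, w k i j = -w k j i
  killing : ∀ i j, w i 4 j + w j 4 i = 0
  nijenhuis : ∀ i j k, i ≠ 4 → j ≠ 4 → k ≠ 4 → nijenhuisCoeff w i j k = 0
  dFund : ∀ i j k, i ≠ 4 → j ≠ 4 → k ≠ 4 → dFundCoeff w i j k = 0

/-- The components of `g(∇_X Y, ξ)` for `X`, `Y` in the frame. -/
def xiPart (w : Tensor3) : Matrix (Fin 5) (Fin 5) ℝ := Matrix.of fun k i ↦ w k i 4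

namespace IsQuasiSasakiForms

variable {w : Tensor3} (hw : IsQuasiSasakiForms w)
include hw

lemma xiPart_mem : xiPart w ∈ horizontalForms := by
  refine ⟨mem_so5_iff.2 fun i j ↦ ?_, fun i ↦ ?_⟩
  · have := hw.killing i j
    rw [hw.skew i 4 j, hw.skew j 4 i] at this
    simp only [xiPart, Matrix.of_apply]
    linarith
  · have := hw.skew i 4 4
    simp only [xiPart, Matrix.of_apply]
    linarith

lemma transverse_kaehler (k : Fin 5) (hk : k ≠ 4) : w k 1 3 = w k 0 2 ∧ w k 1 2 = -w k 0 3 := by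
  have hs := hw.skew
  have n1 := hw.nijenhuis 0 0 2 (by decide) (by decide) (by decide)
  have n2 := hw.nijenhuis 0 0 3 (by decide) (by decide) (by decide)
  have n3 := hw.nijenhuis 2 0 2 (by decide) (by decide) (by decide)
  have n4 := hw.nijenhuis 2 0 3 (by decide) (by decide) (by decide)
  have d1 := hw.dFund 0 1 2 (by decide) (by decide) (by decide)
  have d2 := hw.dFund 0 1 3 (by decide) (by decide) (by decide)
  have d3 := hw.dFund 0 2 3 (by decide) (by decide) (by decide)
  have d4 := hw.dFund 1 2 3 (by decide) (by decide) (by decide)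
  have h10 (k) := hs k 1 0
  have h20 (k) := hs k 2 0
  have h30 (k) := hs k 3 0
  have h21 (k) := hs k 2 1
  have h31 (k) := hs k 3 1
  have h32 (k) := hs k 3 2
  have h0 (k i) : w k i i = 0 := by linarith [hs k i i]
  simp [nijenhuisCoeff, dFundCoeff, nablaFundCoeff, bracketCoeff, phiSgn, phiIdx, eta, h0,
    h10, h20, h30, h21, h31, h32] at n1 n2 n3 n4 d1 d2 d3 d4
  fin_cases k <;> first | exact absurd rfl hk | (constructor <;> simp only [Fin.isValue, Fin.zero_eta,
    Fin.mk_one, Fin.reduceFinMk] <;> linarith)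

lemma prW_eq : prW w = mixedTensor (xiPart w) (prU2Perp (w 4)) := by
  have hB := apply_four_of_mem hw.xiPart_mem
  ext k i j
  change prU2Perp (w k) i j = _
  by_cases hk : k = 4
  · subst hk
    rw [mixedTensor_four _ _ hB]
  obtain ⟨h1, h2⟩ := hw.transverse_kaehler k hk
  have hs := hw.skew k
  have h0 (i) : w k i i = 0 := by linarith [hs i i]
  simp only [prU2Perp_apply, mixedTensor, Matrix.of_apply, xiPart, eta_apply_eq, hk, if_false]
  fin_cases i <;> fin_cases j <;> simp [phiSgn, phiIdx, h0] <;>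
    linarith [hs 1 0, hs 2 0, hs 3 0, hs 2 1, hs 3 1, hs 3 2, hs 4 0, hs 4 1, hs 4 2, hs 4 3]

set_option maxHeartbeats 4000000 in
lemma torsionCoeff_eq (i j k : Fin 5) : torsionCoeff w i j k =
    eta i * (prU2Perp (xiPart w) - prU2Perp (w 4) - (2 : ℝ) • xiPart w) j k
    - eta j * (prU2Perp (xiPart w) - prU2Perp (w 4) - (2 : ℝ) • xiPart w) i k
    + eta k * (-(2 : ℝ) • xiPart w) i j := by
  have hs := hw.skew
  have h10 (k) := hs k 1 0
  have h20 (k) := hs k 2 0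
  have h30 (k) := hs k 3 0
  have h21 (k) := hs k 2 1
  have h31 (k) := hs k 3 1
  have h32 (k) := hs k 3 2
  have h4 (k i) := hs k 4 i
  have h0 (k i) : w k i i = 0 := by linarith [hs k i i]
  have a0 := hw.transverse_kaehler 0 (by decide)
  have a1 := hw.transverse_kaehler 1 (by decide)
  have a2 := hw.transverse_kaehler 2 (by decide)
  have a3 := hw.transverse_kaehler 3 (by decide)
  have hB := mem_so5_iff.1 hw.xiPart_mem.1
  simp only [xiPart, Matrix.of_apply] at hB
  have b10 := hB 1 0
  have b20 := hB 2 0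
  have b30 := hB 3 0
  have b21 := hB 2 1
  have b31 := hB 3 1
  have b32 := hB 3 2
  have b4 (i) : w 4 i 4 = 0 := apply_four_of_mem hw.xiPart_mem i
  have b0 (i) : w i i 4 = 0 := by linarith [hB i i]
  clear hs hw hB
  simp only [torsionCoeff, canonicalCoeff, nijenhuisCoeff, dFundCoeff, nablaFundCoeff, bracketCoeff, dEtaCoeff,
    eta_apply_eq, xiPart, Matrix.sub_apply, Matrix.smul_apply, smul_eq_mul,
    prU2Perp_apply, Matrix.of_apply]
  fin_cases i <;> fin_cases j <;> fin_cases k <;>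
    simp [phiSgn, phiIdx, h0, h10, h20, h30, h21, h31, h32, h4, a0, a1, a2, a3, b10, b20, b30, b21,
      b31, b32, b4, b0] <;> ring

end IsQuasiSasakiForms

end U2Model
end

noncomputable section

lemma mvfderiv_eq_zero_of_eventually_const {E : Type*} [NormedAddCommGroup E] [NormedSpace ℝ E]
    {H : Type*} [TopologicalSpace H] {I : ModelWithCorners ℝ E H} {M : Type*} [TopologicalSpace M]
    [ChartedSpace H M] {f : M → ℝ} {x : M} {c : ℝ} (h : ∀ᶠ y in nhds x, f y = c) : d% f x = 0 := by
  have h1 : f =ᶠ[nhds x] fun _ ↦ c := h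
  have h2 : mfderiv I 𝓘(ℝ, ℝ) f x = mfderiv I 𝓘(ℝ, ℝ) (fun _ : M ↦ c) x :=
    h1.mfderiv_eq
  have h3 : d% (fun _ : M ↦ c) x = 0 := mvfderiv_const c
  ext v
  exact (congrArg (fun L ↦ L v) h2).trans (congrArg (fun L ↦ L v) h3)

namespace AlmostContactMetric

section General

variable {E : Type*} [NormedAddCommGroup E] [NormedSpace ℝ E] [FiniteDimensional ℝ E]
  {H : Type*} [TopologicalSpace H] {I : ModelWithCorners ℝ E H}
  {M : Type*} [TopologicalSpace M] [ChartedSpace H M] [IsManifold I ∞ M]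
  [RiemannianBundle (fun x : M ↦ TangentSpace I x)]

lemma inner_xi_xi (S : AlmostContactMetric I M) (x : M) :
    inner ℝ (S.xi x) (S.xi x) = 1 := by
  rw [real_inner_self_eq_norm_sq, S.norm_xi]; norm_num

lemma inner_xi_phi (S : AlmostContactMetric I M) (x : M) (X : TangentSpace I x) :
    inner ℝ (S.xi x) (S.phi x X) = 0 := by
  have h1 := S.phi_phi x (S.phi x X)
  rw [S.phi_phi x X, map_add, map_neg, map_smul, S.phi_xi, smul_zero, add_zero] at h1
  have h2 : inner ℝ (S.xi x) (S.phi x X) • S.xi x = 0 := by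
    simpa using h1
  have h3 := congrArg (inner ℝ (S.xi x)) h2
  rwa [inner_smul_right, inner_xi_xi, mul_one, inner_zero_right] at h3

lemma inner_phi_right (S : AlmostContactMetric I M) (x : M) (X Y : TangentSpace I x) :
    inner ℝ X (S.phi x Y) = -inner ℝ (S.phi x X) Y := by
  have h := S.inner_phi_phi x X (S.phi x Y)
  rw [S.phi_phi, inner_xi_phi, mul_zero, sub_zero, inner_add_right, inner_neg_right,
    inner_smul_right, real_inner_comm (S.xi x) (S.phi x X), inner_xi_phi, mul_zero, add_zero] at h
  exact h.symm

lemma inner_phi_self (S : AlmostContactMetric I M) (x : M) (X : TangentSpace I x) :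
    inner ℝ X (S.phi x X) = 0 := by
  have h := S.inner_phi_right x X X
  rw [real_inner_comm X (S.phi x X)] at h
  linarith

variable [IsContMDiffRiemannianBundle I ∞ E (fun x : M ↦ TangentSpace I x)]
  (S : AlmostContactMetric I M)

lemma nablaEta_apply {x : M} {Y : Π x : M, TangentSpace I x} (hY : MDiffAt (T% Y) x)
    (v : TangentSpace I x) :
    S.nablaEta x (Y x) v = d% (fun y ↦ S.eta y (Y y)) x v - S.eta x (leviCivita I M Y x v) := by
  rw [nablaEta, TensorialAt.mkHom_apply _ hY]
  rfl

lemma nablaFundForm_apply {x : M} {Y Z : Π x : M, TangentSpace I x} (hY : MDiffAt (T% Y) x)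
    (hZ : MDiffAt (T% Z) x) (v : TangentSpace I x) :
    S.nablaFundForm x (Y x) (Z x) v = d% (fun y ↦ S.fundForm y (Y y) (Z y)) x v
      - S.fundForm x (leviCivita I M Y x v) (Z x) - S.fundForm x (Y x) (leviCivita I M Z x v) := by
  rw [nablaFundForm, TensorialAt.mkHom₂_apply _ _ hY hZ, nablaFundFormAux_apply]

lemma nijenhuisTorsion_apply {x : M} {Y Z : Π x : M, TangentSpace I x} (hY : MDiffAt (T% Y) x)
    (hZ : MDiffAt (T% Z) x) :
    S.nijenhuisTorsion x (Y x) (Z x) = S.nijenhuisTorsionAux Y Z x := by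
  rw [nijenhuisTorsion, TensorialAt.mkHom₂_apply _ _ hY hZ]

lemma canonicalTorsion_eq (x : M) (X Y Z : TangentSpace I x) :
    S.canonicalTorsion x X Y Z = S.canonicalTensor x X Y Z - S.canonicalTensor x Y X Z := by
  have hX := FiberBundle.mdifferentiableAt_extend I E X
  have hY := FiberBundle.mdifferentiableAt_extend I E Y
  have h := (CovariantDerivative.torsion_eq_zero_iff _).1 (leviCivita_torsion (I := I) (M := M))
    hX hY
  rw [canonicalTorsion, CovariantDerivative.torsion_apply_eq_extend, ← h, inner_sub_left,
    inner_sub_left, inner_canonicalConnection, inner_canonicalConnection, inner_sub_left]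
  simp only [FiberBundle.extend_apply_self]
  ring

end General

variable {M : Type*} [TopologicalSpace M] [ChartedSpace (EuclideanSpace ℝ (Fin 5)) M]
  [IsManifold (𝓡 5) ∞ M] [RiemannianBundle (fun x : M ↦ TangentSpace (𝓡 5) x)]

lemma finrank_tangentSpace (x : M) : Module.finrank ℝ (TangentSpace (𝓡 5) x) = 5 :=
  (finrank_euclideanSpace_fin (𝕜 := ℝ) (n := 5))

variable {S : AlmostContactMetric (𝓡 5) M}

namespace AdaptedFrame

variable {x : M} (F : S.AdaptedFrame x)

/-- The orthonormal basis of the tangent space at a point that is given by an adapted frame. -/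
def basis {y : M} (hy : y ∈ F.domain) : OrthonormalBasis (Fin 5) ℝ (TangentSpace (𝓡 5) y) :=
  OrthonormalBasis.mk (F.orthonormal y hy)
    ((F.orthonormal y hy).linearIndependent.span_eq_top_of_card_eq_finrank'
      (by rw [finrank_tangentSpace, Fintype.card_fin])).ge

@[simp] lemma basis_apply {y : M} (hy : y ∈ F.domain) (i : Fin 5) : F.basis hy i = F.e i y := by
  simp [basis]

lemma eventually_mem : ∀ᶠ y in nhds x, y ∈ F.domain := F.isOpen_domain.mem_nhds F.mem_domain

lemma mdifferentiableAt (i : Fin 5) : MDifferentiableAt (𝓡 5) (𝓡 5).tangent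
    (fun y ↦ (⟨y, F.e i y⟩ : TangentBundle (𝓡 5) M)) x :=
  ((F.contMDiffOn i).contMDiffAt F.eventually_mem).mdifferentiableAt (by simp)

lemma inner_e {y : M} (hy : y ∈ F.domain) (i j : Fin 5) :
    inner ℝ (F.e i y) (F.e j y) = if i = j then 1 else 0 :=
  orthonormal_iff_ite.1 (F.orthonormal y hy) i j

lemma phi_e {y : M} (hy : y ∈ F.domain) (j : Fin 5) :
    S.phi y (F.e j y) = U2Model.phiSgn j • F.e (U2Model.phiIdx j) y := by
  refine InnerProductSpace.ext_inner_left_basis (𝕜 := ℝ) (F.basis hy).toBasis ?_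
  intro i
  have h := F.fundForm_apply y hy i j
  rw [fundForm, U2Model.Phi_apply] at h
  rw [OrthonormalBasis.coe_toBasis, basis_apply, h, inner_smul_right, F.inner_e hy]
  simp

lemma e_four {y : M} (hy : y ∈ F.domain) : F.e 4 y = S.xi y := by
  refine InnerProductSpace.ext_inner_left_basis (𝕜 := ℝ) (F.basis hy).toBasis ?_
  intro i
  have h := F.eta_apply y hy i
  change inner ℝ (S.xi y) (F.e i y) = _ at h
  rw [U2Model.eta_apply_eq, real_inner_comm] at h
  rw [OrthonormalBasis.coe_toBasis, basis_apply, h, F.inner_e hy]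

lemma eta_e {y : M} (hy : y ∈ F.domain) (v : TangentSpace (𝓡 5) y) :
    S.eta y v = inner ℝ (F.e 4 y) v := by
  rw [F.e_four hy]
  rfl

lemma inner_phi_left {y : M} (hy : y ∈ F.domain) (i : Fin 5) (v : TangentSpace (𝓡 5) y) :
    inner ℝ (F.e i y) (S.phi y v) =
      -(U2Model.phiSgn i * inner ℝ (F.e (U2Model.phiIdx i) y) v) := by
  rw [S.inner_phi_right, F.phi_e hy, inner_smul_left]
  rfl

variable [IsContMDiffRiemannianBundle (𝓡 5) ∞ (EuclideanSpace ℝ (Fin 5))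
  (fun x : M ↦ TangentSpace (𝓡 5) x)]

lemma connectionForms_apply (k i j : Fin 5) : F.connectionForms k i j =
    inner ℝ (leviCivita (𝓡 5) M (F.e i) x (F.e k x)) (F.e j x) := rfl

lemma connectionForms_skew (k i j : Fin 5) :
    F.connectionForms k i j = -F.connectionForms k j i := by
  have h := leviCivita_metric (F.e k x) (F.mdifferentiableAt i) (F.mdifferentiableAt j)
  rw [mvfderiv_eq_zero_of_eventually_const (c := if i = j then 1 else 0)
    (F.eventually_mem.mono fun y hy ↦ F.inner_e hy i j)] at h
  rw [real_inner_comm _ (F.e i x)] at h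
  simp only [connectionForms_apply]
  simp only [zero_apply] at h
  linarith

lemma nablaEta_e (i k : Fin 5) :
    S.nablaEta x (F.e i x) (F.e k x) = -F.connectionForms k i 4 := by
  rw [S.nablaEta_apply (F.mdifferentiableAt i), mvfderiv_eq_zero_of_eventually_const
    (F.eventually_mem.mono fun y hy ↦ F.eta_apply y hy i), zero_apply, zero_sub,
    F.eta_e F.mem_domain, real_inner_comm]
  rfl

lemma dEta_e (i j : Fin 5) :
    S.dEta x (F.e i x) (F.e j x) = U2Model.dEtaCoeff F.connectionForms i j := by
  rw [dEta, nablaEta_e, nablaEta_e, U2Model.dEtaCoeff]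
  ring

lemma nablaFundForm_e (k i j : Fin 5) :
    S.nablaFundForm x (F.e i x) (F.e j x) (F.e k x) =
      U2Model.nablaFundCoeff F.connectionForms k i j := by
  rw [S.nablaFundForm_apply (F.mdifferentiableAt i) (F.mdifferentiableAt j),
    mvfderiv_eq_zero_of_eventually_const
    (F.eventually_mem.mono fun y hy ↦ F.fundForm_apply y hy i j), zero_apply, zero_sub,
    fundForm, fundForm, F.phi_e F.mem_domain, inner_smul_right, F.inner_phi_left F.mem_domain,
    real_inner_comm _ (F.e (U2Model.phiIdx i) x), U2Model.nablaFundCoeff]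
  simp only [connectionForms_apply]
  ring

lemma dFundForm_e (i j k : Fin 5) :
    S.dFundForm x (F.e i x) (F.e j x) (F.e k x) = U2Model.dFundCoeff F.connectionForms i j k := by
  simp only [dFundForm, nablaFundForm_e, U2Model.dFundCoeff]

lemma inner_mlieBracket_e (i j k : Fin 5) :
    inner ℝ (F.e k x) (VectorField.mlieBracket (𝓡 5) (F.e i) (F.e j) x) =
      U2Model.bracketCoeff F.connectionForms i j k := by
  have h := (CovariantDerivative.torsion_eq_zero_iff _).1
    (leviCivita_torsion (I := 𝓡 5) (M := M)) (F.mdifferentiableAt i) (F.mdifferentiableAt j)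
  rw [← h, real_inner_comm, inner_sub_left]
  rfl

lemma nijenhuis_e (i j k : Fin 5) :
    S.nijenhuis x (F.e i x) (F.e j x) (F.e k x) =
      U2Model.nijenhuisCoeff F.connectionForms i j k := by
  have hphi (j : Fin 5) : (fun y ↦ S.phi y (F.e j y)) =ᶠ[nhds x]
      U2Model.phiSgn j • F.e (U2Model.phiIdx j) :=
    F.eventually_mem.mono fun y hy ↦ F.phi_e hy j
  rw [nijenhuis, S.nijenhuisTorsion_apply (F.mdifferentiableAt j) (F.mdifferentiableAt k),
    nijenhuisTorsionAux, F.dEta_e,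
    (hphi j).mlieBracket_vectorField_eq (hphi k),
    (hphi j).mlieBracket_vectorField_eq (Filter.EventuallyEq.refl _ (F.e k)),
    (Filter.EventuallyEq.refl _ (F.e j)).mlieBracket_vectorField_eq (hphi k),
    VectorField.mlieBracket_const_smul_left (F.mdifferentiableAt _),
    VectorField.mlieBracket_const_smul_right (F.mdifferentiableAt _),
    VectorField.mlieBracket_const_smul_left (F.mdifferentiableAt _),
    VectorField.mlieBracket_const_smul_right (F.mdifferentiableAt _)]
  have hidx : U2Model.phiIdx (U2Model.phiIdx i) = i := by revert i; decide
  have hsgn : U2Model.phiSgn i * U2Model.phiSgn (U2Model.phiIdx i) = -U2Model.phiSgn i ^ 2 := by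
    fin_cases i <;> simp [U2Model.phiSgn, U2Model.phiIdx]
  have heta : S.eta x (F.e i x) = U2Model.eta i := F.eta_apply x F.mem_domain i
  simp only [inner_sub_right, inner_add_right, F.inner_phi_left F.mem_domain, map_smul,
    inner_smul_right, F.inner_mlieBracket_e, hidx, heta, U2Model.nijenhuisCoeff]
  linear_combination (U2Model.bracketCoeff F.connectionForms j k i) * hsgn

set_option synthInstance.maxHeartbeats 200000 in
lemma gamma_e (i j : Fin 5) : S.gamma x (F.e i x) (F.e j x) =
    U2Model.phiSgn i * U2Model.dFundCoeff F.connectionForms 4 (U2Model.phiIdx i) j := by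
  rw [gamma, F.phi_e F.mem_domain, ← F.e_four F.mem_domain, ← F.dFundForm_e]
  simp only [dFundForm, map_smul, smul_apply, smul_eq_mul]
  ring

lemma canonicalTorsion_e (i j k : Fin 5) :
    S.canonicalTorsion x (F.e i x) (F.e j x) (F.e k x) =
      U2Model.torsionCoeff F.connectionForms i j k := by
  have heta (i : Fin 5) : S.eta x (F.e i x) = U2Model.eta i := F.eta_apply x F.mem_domain i
  simp only [canonicalTorsion_eq, canonicalTensor, F.dEta_e, F.gamma_e, F.nijenhuis_e, heta,
    U2Model.torsionCoeff, U2Model.canonicalCoeff]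

lemma isQuasiSasakiForms (hS : S.IsGeneralizedQuasiSasaki) :
    U2Model.IsQuasiSasakiForms F.connectionForms where
  skew := F.connectionForms_skew
  killing i j := by
    have h := hS.isKilling x (F.e i x) (F.e j x)
    have hxi (v : TangentSpace (𝓡 5) x) :
        leviCivita (𝓡 5) M S.xi x v = leviCivita (𝓡 5) M (F.e 4) x v := by
      rw [(leviCivita (𝓡 5) M).isCovariantDerivativeOn.congr_of_eventuallyEq
        (S.mdifferentiableAt_xi x) (F.mdifferentiableAt 4) Filter.univ_mem
        (F.eventually_mem.mono fun y hy ↦ (F.e_four hy).symm)]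
    rw [hxi, hxi] at h
    exact h
  nijenhuis i j k hi hj hk := by
    rw [← F.nijenhuis_e]
    refine hS.nijenhuis_eq_zero x _ _ _ ?_ ?_ ?_ <;>
      simp [← F.e_four F.mem_domain, F.inner_e F.mem_domain, Ne.symm, *]
  dFund i j k hi hj hk := by
    rw [← F.dFundForm_e]
    refine hS.dFundForm_eq_zero x _ _ _ ?_ ?_ ?_ <;>
      simp [← F.e_four F.mem_domain, F.inner_e F.mem_domain, Ne.symm, *]

end AdaptedFrame

end AlmostContactMetric
end

noncomputable section

namespace AlmostContactMetric

variable {M : Type*} [TopologicalSpace M] [ChartedSpace (EuclideanSpace ℝ (Fin 5)) M]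
  [IsManifold (𝓡 5) ∞ M] [RiemannianBundle (fun x : M ↦ TangentSpace (𝓡 5) x)]
  [IsContMDiffRiemannianBundle (𝓡 5) ∞ (EuclideanSpace ℝ (Fin 5))
    (fun x : M ↦ TangentSpace (𝓡 5) x)]

lemma exists_unit_normal_field {n : ℕ} (hn : n < 5) {x : M} {U : Set M} (hU : IsOpen U)
    (hx : x ∈ U) {s : Fin n → Π y : M, TangentSpace (𝓡 5) y}
    (hs : ∀ i, ContMDiffOn (𝓡 5) (𝓡 5).tangent ∞
      (fun y ↦ (⟨y, s i y⟩ : TangentBundle (𝓡 5) M)) U)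
    (ho : ∀ y ∈ U, Orthonormal ℝ fun i ↦ s i y) :
    ∃ V ⊆ U, IsOpen V ∧ x ∈ V ∧ ∃ e : Π y : M, TangentSpace (𝓡 5) y,
      ContMDiffOn (𝓡 5) (𝓡 5).tangent ∞ (fun y ↦ (⟨y, e y⟩ : TangentBundle (𝓡 5) M)) V ∧
      ∀ y ∈ V, inner ℝ (e y) (e y) = 1 ∧ ∀ i, inner ℝ (s i y) (e y) = 0 := by
  obtain ⟨v, hv, hv0⟩ : ∃ v ∈ (Submodule.span ℝ (Set.range fun i ↦ s i x))ᗮ, v ≠ 0 := by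
    apply Submodule.exists_mem_ne_zero_of_ne_bot
    rw [Ne, Submodule.orthogonal_eq_bot_iff]
    intro h
    have h1 := finrank_range_le_card (R := ℝ) (fun i ↦ s i x)
    rw [Set.finrank, h, finrank_top, finrank_tangentSpace, Fintype.card_fin] at h1
    omega
  have hvs (i : Fin n) : inner ℝ (s i x) v = 0 :=
    hv (s i x) (Submodule.subset_span ⟨i, rfl⟩)
  obtain ⟨N, hN, hW⟩ := FiberBundle.exists_contMDiffOn_extend (k := ∞) (𝓡 5)
    (EuclideanSpace ℝ (Fin 5)) (V := fun y : M ↦ TangentSpace (𝓡 5) y) v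
  set W : Π y : M, TangentSpace (𝓡 5) y := FiberBundle.extend (EuclideanSpace ℝ (Fin 5)) v with hWdef
  have hWx : W x = v := FiberBundle.extend_apply_self ..
  let U₁ := U ∩ interior N
  have hU₁ : IsOpen U₁ := hU.inter isOpen_interior
  have hW₁ : ContMDiffOn (𝓡 5) (𝓡 5).tangent ∞ (fun y ↦ (⟨y, W y⟩ : TangentBundle (𝓡 5) M)) U₁ :=
    hW.mono (Set.inter_subset_right.trans interior_subset)
  have hs₁ (i : Fin n) := (hs i).mono (Set.inter_subset_left : U₁ ⊆ U)
  let P : Π y : M, TangentSpace (𝓡 5) y := W - fun y ↦ ∑ i, inner ℝ (s i y) (W y) • s i y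
  have hP : ContMDiffOn (𝓡 5) (𝓡 5).tangent ∞ (fun y ↦ (⟨y, P y⟩ : TangentBundle (𝓡 5) M)) U₁ := by
    refine ContMDiffOn.sub_section hW₁ (ContMDiffOn.sum_section fun i _ ↦ ?_)
    exact ContMDiffOn.smul_section (ContMDiffOn.inner_bundle (hs₁ i) hW₁) (hs₁ i)
  have hq : ContMDiffOn (𝓡 5) 𝓘(ℝ, ℝ) ∞ (fun y ↦ inner ℝ (P y) (P y)) U₁ :=
    ContMDiffOn.inner_bundle hP hP
  have hPs (y : M) (hy : y ∈ U) (i : Fin n) : inner ℝ (s i y) (P y) = 0 := by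
    change inner ℝ (s i y) (W y - ∑ j, inner ℝ (s j y) (W y) • s j y) = 0
    rw [inner_sub_right, (ho y hy).inner_right_fintype, sub_self]
  have hPx : P x = v := by
    change W x - ∑ j, inner ℝ (s j x) (W x) • s j x = v
    simp [hWx, hvs]
  refine ⟨U₁ ∩ (fun y ↦ inner ℝ (P y) (P y)) ⁻¹' {0}ᶜ,
    Set.inter_subset_left.trans Set.inter_subset_left,
    hq.continuousOn.isOpen_inter_preimage hU₁ isOpen_compl_singleton,
    ⟨⟨hx, mem_interior_iff_mem_nhds.2 hN⟩, by simpa [hPx] using hv0⟩,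
    (fun y ↦ (√(inner ℝ (P y) (P y)))⁻¹) • P, ?_, ?_⟩
  · refine ContMDiffOn.smul_section (fun y hy ↦ ?_) (hP.mono Set.inter_subset_left)
    have hy0 : inner ℝ (P y) (P y) ≠ 0 := hy.2
    have h1 : ContDiffAt ℝ ∞ (fun t : ℝ ↦ (√t)⁻¹) (inner ℝ (P y) (P y)) :=
      (Real.contDiffAt_sqrt hy0).inv
        (Real.sqrt_ne_zero'.2 (lt_of_le_of_ne real_inner_self_nonneg hy0.symm))
    exact ContDiffAt.comp_contMDiffWithinAt (f := fun y ↦ inner ℝ (P y) (P y)) h1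
      ((hq y hy.1).mono Set.inter_subset_left)
  · intro y hy
    have hy0 : inner ℝ (P y) (P y) ≠ 0 := hy.2
    have hpos := lt_of_le_of_ne real_inner_self_nonneg hy0.symm
    constructor
    · change inner ℝ ((√(inner ℝ (P y) (P y)))⁻¹ • P y) ((√(inner ℝ (P y) (P y)))⁻¹ • P y) = 1
      rw [inner_smul_left, inner_smul_right, ← mul_assoc]
      change (√(inner ℝ (P y) (P y)))⁻¹ * (√(inner ℝ (P y) (P y)))⁻¹ * _ = 1
      rw [← mul_inv, Real.mul_self_sqrt hpos.le, inv_mul_cancel₀ hy0]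
    · intro i
      change inner ℝ (s i y) ((√(inner ℝ (P y) (P y)))⁻¹ • P y) = 0
      rw [inner_smul_right, hPs y hy.1.1, mul_zero]

end AlmostContactMetric
end

noncomputable section

lemma orthonormal_of_lt {V : Type*} [NormedAddCommGroup V] [InnerProductSpace ℝ V] {ι : Type*}
    [LinearOrder ι] {f : ι → V} (h1 : ∀ i, inner ℝ (f i) (f i) = 1)
    (h2 : ∀ i j, i < j → inner ℝ (f i) (f j) = 0) : Orthonormal ℝ f := by
  classical
  rw [orthonormal_iff_ite]
  intro i j
  rcases lt_trichotomy i j with h | rfl | h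
  · rw [h2 i j h, if_neg h.ne]
  · rw [h1, if_pos rfl]
  · rw [real_inner_comm, h2 j i h, if_neg h.ne']

namespace AlmostContactMetric

variable {M : Type*} [TopologicalSpace M] [ChartedSpace (EuclideanSpace ℝ (Fin 5)) M]
  [IsManifold (𝓡 5) ∞ M] [RiemannianBundle (fun x : M ↦ TangentSpace (𝓡 5) x)]
  [IsContMDiffRiemannianBundle (𝓡 5) ∞ (EuclideanSpace ℝ (Fin 5))
    (fun x : M ↦ TangentSpace (𝓡 5) x)]

/-- Adapted frames exist around every point. -/
theorem nonempty_adaptedFrame (S : AlmostContactMetric (𝓡 5) M) (x : M) :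
    Nonempty (S.AdaptedFrame x) := by
  have hphi {V : Set M} {e : Π y : M, TangentSpace (𝓡 5) y}
      (he : ContMDiffOn (𝓡 5) (𝓡 5).tangent ∞ (fun y ↦ (⟨y, e y⟩ : TangentBundle (𝓡 5) M)) V) :
      ContMDiffOn (𝓡 5) (𝓡 5).tangent ∞
        (fun y ↦ (⟨y, S.phi y (e y)⟩ : TangentBundle (𝓡 5) M)) V :=
    ContMDiffOn.clm_bundle_apply S.contMDiff_phi.contMDiffOn he
  have hxi (V : Set M) : ContMDiffOn (𝓡 5) (𝓡 5).tangent ∞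
      (fun y ↦ (⟨y, S.xi y⟩ : TangentBundle (𝓡 5) M)) V := S.contMDiff_xi.contMDiffOn
  obtain ⟨V, -, hV, hxV, u, hu, hu'⟩ := exists_unit_normal_field (n := 1) (by norm_num)
    isOpen_univ (Set.mem_univ x) (s := ![S.xi]) (fun i ↦ by fin_cases i; exact hxi _)
    (fun y _ ↦ ⟨fun i ↦ by fin_cases i; exact S.norm_xi y, fun i j h ↦ (h (Subsingleton.elim _ _)).elim⟩)
  have huu (y : M) (hy : y ∈ V) := (hu' y hy).1
  have hxu (y : M) (hy : y ∈ V) : inner ℝ (S.xi y) (u y) = 0 := (hu' y hy).2 0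
  have hpp (y : M) (hy : y ∈ V) : inner ℝ (S.phi y (u y)) (S.phi y (u y)) = 1 := by
    rw [S.inner_phi_phi, hxu y hy, huu y hy]; norm_num
  obtain ⟨V', hVV', hV', hxV', v, hv, hv'⟩ := exists_unit_normal_field (n := 3) (by norm_num)
    hV hxV (s := ![S.xi, u, fun y ↦ S.phi y (u y)])
    (fun i ↦ by fin_cases i; exacts [hxi _, hu, hphi hu])
    (fun y hy ↦ by
      refine orthonormal_of_lt (fun i ↦ ?_) (fun i j hij ↦ ?_)
      · fin_cases i
        exacts [S.inner_xi_xi y, huu y hy, hpp y hy]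
      · fin_cases i <;> fin_cases j <;> first | exact absurd hij (by decide) | skip
        exacts [hxu y hy, S.inner_xi_phi y _, S.inner_phi_self y _])
  let f : Fin 5 → Π y : M, TangentSpace (𝓡 5) y :=
    ![u, fun y ↦ -S.phi y (u y), v, fun y ↦ -S.phi y (v y), S.xi]
  have hon (y : M) (hy : y ∈ V') : Orthonormal ℝ fun i ↦ f i y := by
    have hy' := hVV' hy
    have hvv : inner ℝ (v y) (v y) = 1 := (hv' y hy).1
    have hxv : inner ℝ (S.xi y) (v y) = 0 := (hv' y hy).2 0
    have huv : inner ℝ (u y) (v y) = 0 := (hv' y hy).2 1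
    have hpuv : inner ℝ (S.phi y (u y)) (v y) = 0 := (hv' y hy).2 2
    refine orthonormal_of_lt (fun i ↦ ?_) (fun i j hij ↦ ?_)
    · fin_cases i
      · exact huu y hy'
      · exact (inner_neg_neg _ _).trans (hpp y hy')
      · exact hvv
      · exact (inner_neg_neg _ _).trans (by rw [S.inner_phi_phi, hxv, hvv]; norm_num)
      · exact S.inner_xi_xi y
    · fin_cases i <;> fin_cases j <;> first | exact absurd hij (by decide) | skip
      · change inner ℝ (u y) (-S.phi y (u y)) = (0 : ℝ)
        rw [inner_neg_right, S.inner_phi_self, neg_zero]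
      · exact huv
      · change inner ℝ (u y) (-S.phi y (v y)) = (0 : ℝ)
        rw [inner_neg_right, S.inner_phi_right, hpuv, neg_zero, neg_zero]
      · change inner ℝ (u y) (S.xi y) = (0 : ℝ)
        rw [real_inner_comm, hxu y hy']
      · change inner ℝ (-S.phi y (u y)) (v y) = (0 : ℝ)
        rw [inner_neg_left, hpuv, neg_zero]
      · change inner ℝ (-S.phi y (u y)) (-S.phi y (v y)) = (0 : ℝ)
        rw [inner_neg_neg, S.inner_phi_phi, hxu y hy', huv, zero_mul, sub_zero]
      · change inner ℝ (-S.phi y (u y)) (S.xi y) = (0 : ℝ)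
        rw [inner_neg_left, real_inner_comm, S.inner_xi_phi, neg_zero]
      · change inner ℝ (v y) (-S.phi y (v y)) = (0 : ℝ)
        rw [inner_neg_right, S.inner_phi_self, neg_zero]
      · change inner ℝ (v y) (S.xi y) = (0 : ℝ)
        rw [real_inner_comm, hxv]
      · change inner ℝ (-S.phi y (v y)) (S.xi y) = (0 : ℝ)
        rw [inner_neg_left, real_inner_comm, S.inner_xi_phi, neg_zero]
  have hphif (y : M) (hy : y ∈ V') (j : Fin 5) :
      S.phi y (f j y) = U2Model.phiSgn j • f (U2Model.phiIdx j) y := by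
    have hxv : inner ℝ (S.xi y) (v y) = 0 := (hv' y hy).2 0
    fin_cases j
    · change S.phi y (u y) = (-1 : ℝ) • -S.phi y (u y)
      rw [neg_one_smul, neg_neg]
    · change S.phi y (-S.phi y (u y)) = (1 : ℝ) • u y
      rw [map_neg, S.phi_phi, hxu y (hVV' hy), zero_smul, add_zero, neg_neg, one_smul]
    · change S.phi y (v y) = (-1 : ℝ) • -S.phi y (v y)
      rw [neg_one_smul, neg_neg]
    · change S.phi y (-S.phi y (v y)) = (1 : ℝ) • v y
      rw [map_neg, S.phi_phi, hxv, zero_smul, add_zero, neg_neg, one_smul]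
    · change S.phi y (S.xi y) = (0 : ℝ) • S.xi y
      rw [S.phi_xi, zero_smul]
  exact ⟨{
    domain := V'
    isOpen_domain := hV'
    mem_domain := hxV'
    e := f
    contMDiffOn := fun i ↦ by
      fin_cases i
      exacts [hu.mono hVV', ContMDiffOn.neg_section (hphi (hu.mono hVV')), hv,
        ContMDiffOn.neg_section (hphi hv), hxi _]
    orthonormal := hon
    fundForm_apply := fun y hy i j ↦ by
      rw [fundForm, hphif y hy, inner_smul_right, orthonormal_iff_ite.1 (hon y hy),
        U2Model.Phi_apply, mul_ite, mul_one, mul_zero]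
    eta_apply := fun y hy i ↦ by
      have h := orthonormal_iff_ite.1 (hon y hy) 4 i
      rw [U2Model.eta_apply_eq]
      simp only [eq_comm (a := i)]
      exact h }⟩

end AlmostContactMetric
end

noncomputable section

namespace U2Model

namespace IsQuasiSasakiForms

variable {w : Tensor3} (hw : IsQuasiSasakiForms w)
include hw

lemma four_mem : w 4 ∈ horizontalForms := by
  refine ⟨mem_so5_iff.2 (hw.skew 4), fun i ↦ ?_⟩
  exact apply_four_of_mem hw.xiPart_mem i

/-- The torsion has components `η ∧ α` in the first two slots and `β ⊗ η`, for 2-forms `α`, `β`. -/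
lemma exists_torsionCoeff_eq : ∃ α ∈ horizontalForms, ∃ β ∈ horizontalForms,
    α = prU2Perp (xiPart w) - prU2Perp (w 4) - (2 : ℝ) • xiPart w ∧ β = -(2 : ℝ) • xiPart w ∧
    ∀ i j k, torsionCoeff w i j k = eta i * α j k - eta j * α i k + eta k * β i j :=
  have hB := hw.xiPart_mem
  ⟨_, Submodule.sub_mem _ (Submodule.sub_mem _ (prU2Perp_mem_horizontalForms hB)
      (prU2Perp_mem_horizontalForms hw.four_mem)) (Submodule.smul_mem _ _ hB),
    _, Submodule.smul_mem _ _ hB, rfl, rfl, hw.torsionCoeff_eq⟩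

lemma totallySkew_iff :
    (∀ i j k, torsionCoeff w i j k + torsionCoeff w i k j = 0) ↔ prW w ∈ W3 ⊔ W4 ⊔ W5 := by
  obtain ⟨α, hα, β, hβ, eα, eβ, h⟩ := hw.exists_torsionCoeff_eq
  have hs := mem_so5_iff.1 hα.1
  rw [hw.prW_eq, mem_W3_sup_W4_sup_W5_iff hw.xiPart_mem]
  have key : prU2Perp (w 4) = prU2Perp (xiPart w) ↔ α = β := by
    rw [eα, eβ, ← sub_eq_zero (b := -(2 : ℝ) • xiPart w), eq_comm, ← sub_eq_zero]
    simp
  rw [key]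
  simp only [h]
  constructor
  · intro h1
    ext j k
    have h2 := h1 j 4 k
    rw [apply_four_of_mem hα, hβ.2, hα.2, hα.2, show eta 4 = 1 by simp [eta]] at h2
    linarith
  · rintro rfl i j k
    rw [hs k j, hs i j, hs i k]
    ring

lemma cyclic_iff :
    (∀ i j k, torsionCoeff w i j k + torsionCoeff w j k i + torsionCoeff w k i j = 0) ↔
      prW w ∈ W7 := by
  obtain ⟨α, hα, β, hβ, eα, eβ, h⟩ := hw.exists_torsionCoeff_eq
  have hs := mem_so5_iff.1 hα.1
  have hB := hw.xiPart_mem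
  rw [hw.prW_eq, mem_W7_iff hB]
  have key : (prU2Perp (xiPart w) = xiPart w ∧ prU2Perp (w 4) = -(2 : ℝ) • xiPart w) ↔
      (2 : ℝ) • α + β = 0 := by
    rw [eα, eβ]
    constructor
    · rintro ⟨h1, h2⟩
      rw [h1, h2]
      module
    · intro h1
      have h2 : prU2Perp (w 4) = prU2Perp (xiPart w) - (3 : ℝ) • xiPart w := by
        refine sub_eq_zero.1 (Eq.trans ?_ ((congrArg ((-(1 / 2) : ℝ) • ·) h1).trans (smul_zero _)))
        module
      have h3 := prU2Perp_prU2Perp hw.four_mem.1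
      rw [h2, map_sub, map_smul, prU2Perp_prU2Perp hB.1] at h3
      have h4 : prU2Perp (xiPart w) = xiPart w := by
        refine sub_eq_zero.1
          (Eq.trans ?_ ((congrArg ((-(1 / 3) : ℝ) • ·) (sub_eq_zero.2 h3)).trans (smul_zero _)))
        module
      refine ⟨h4, ?_⟩
      rw [h2, h4]
      module
  rw [key]
  simp only [h]
  constructor
  · intro h1
    ext j k
    have h2 := h1 4 j k
    simp only [apply_four_of_mem hα, apply_four_of_mem hβ, hα.2, hβ.2,
      show eta 4 = 1 by simp [eta], hs k j] at h2
    simp only [Matrix.add_apply, Matrix.smul_apply, smul_eq_mul, Matrix.zero_apply]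
    linarith
  · intro h1 i j k
    have h2 (i j : Fin 5) : β i j = -2 * α i j := by
      have h3 := congrFun (congrFun h1 i) j
      simp only [Matrix.add_apply, Matrix.smul_apply, smul_eq_mul, Matrix.zero_apply] at h3
      linarith
    rw [h2, h2, h2, hs k j, hs j i, hs i k]
    ring

lemma sum_torsionCoeff (i : Fin 5) : ∑ j, torsionCoeff w i j j = 0 := by
  obtain ⟨α, hα, β, hβ, -, -, h⟩ := hw.exists_torsionCoeff_eq
  refine Finset.sum_eq_zero fun j _ ↦ ?_
  have h1 : α j j = 0 := by linarith [mem_so5_iff.1 hα.1 j j]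
  rw [h, h1, eta_apply_eq j]
  split_ifs with hj
  · rw [hj, hα.2, hβ.2]; ring
  · ring

end IsQuasiSasakiForms

end U2Model

namespace AlmostContactMetric

variable {M : Type*} [TopologicalSpace M] [ChartedSpace (EuclideanSpace ℝ (Fin 5)) M]
  [IsManifold (𝓡 5) ∞ M] [RiemannianBundle (fun x : M ↦ TangentSpace (𝓡 5) x)]
  [IsContMDiffRiemannianBundle (𝓡 5) ∞ (EuclideanSpace ℝ (Fin 5))
    (fun x : M ↦ TangentSpace (𝓡 5) x)]
  {S : AlmostContactMetric (𝓡 5) M}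

namespace AdaptedFrame

variable {x : M} (F : S.AdaptedFrame x)

lemma sum_inner_smul_e (X : TangentSpace (𝓡 5) x) : ∑ i, inner ℝ (F.e i x) X • F.e i x = X := by
  simpa using (F.basis F.mem_domain).sum_repr' X

lemma canonicalTorsion_eq_sum (X Y Z : TangentSpace (𝓡 5) x) : S.canonicalTorsion x X Y Z =
    ∑ i, ∑ j, ∑ k, inner ℝ (F.e i x) X * inner ℝ (F.e j x) Y * inner ℝ (F.e k x) Z *
      U2Model.torsionCoeff F.connectionForms i j k := by
  have h1 (Y Z : TangentSpace (𝓡 5) x) : S.canonicalTorsion x X Y Z =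
      ∑ i, inner ℝ (F.e i x) X * S.canonicalTorsion x (F.e i x) Y Z := by
    conv_lhs => rw [← F.sum_inner_smul_e X]
    simp only [canonicalTorsion, map_sum, map_smul, sum_apply, smul_apply, sum_inner,
      inner_smul_left, RCLike.conj_to_real]
  have h2 (X Z : TangentSpace (𝓡 5) x) : S.canonicalTorsion x X Y Z =
      ∑ j, inner ℝ (F.e j x) Y * S.canonicalTorsion x X (F.e j x) Z := by
    conv_lhs => rw [← F.sum_inner_smul_e Y]
    simp only [canonicalTorsion, map_sum, map_smul, sum_inner, inner_smul_left,
      RCLike.conj_to_real]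
  have h3 (X Y : TangentSpace (𝓡 5) x) : S.canonicalTorsion x X Y Z =
      ∑ k, inner ℝ (F.e k x) Z * S.canonicalTorsion x X Y (F.e k x) := by
    conv_lhs => rw [← F.sum_inner_smul_e Z]
    simp only [canonicalTorsion, inner_sum, inner_smul_right]
  rw [h1]
  refine Finset.sum_congr rfl fun i _ ↦ ?_
  rw [h2, Finset.mul_sum]
  refine Finset.sum_congr rfl fun j _ ↦ ?_
  rw [h3, Finset.mul_sum, Finset.mul_sum]
  refine Finset.sum_congr rfl fun k _ ↦ ?_
  rw [F.canonicalTorsion_e]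
  ring

lemma totallySkew_iff (hS : S.IsGeneralizedQuasiSasaki) :
    (∀ X Y Z, S.canonicalTorsion x X Y Z + S.canonicalTorsion x X Z Y = 0) ↔
      F.intrinsicTorsion ∈ U2Model.W3 ⊔ U2Model.W4 ⊔ U2Model.W5 := by
  rw [intrinsicTorsion, ← (F.isQuasiSasakiForms hS).totallySkew_iff]
  constructor
  · intro h i j k
    rw [← F.canonicalTorsion_e, ← F.canonicalTorsion_e, h]
  · intro h X Y Z
    rw [F.canonicalTorsion_eq_sum X Y Z, F.canonicalTorsion_eq_sum X Z Y, ← Finset.sum_add_distrib]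
    refine Finset.sum_eq_zero fun i _ ↦ ?_
    rw [Finset.sum_comm (γ := Fin 5) (f := fun j k ↦ inner ℝ (F.e i x) X * inner ℝ (F.e j x) Z *
      inner ℝ (F.e k x) Y * _), ← Finset.sum_add_distrib]
    refine Finset.sum_eq_zero fun j _ ↦ ?_
    rw [← Finset.sum_add_distrib]
    refine Finset.sum_eq_zero fun k _ ↦ ?_
    linear_combination (inner ℝ (F.e i x) X * inner ℝ (F.e j x) Y * inner ℝ (F.e k x) Z) * h i j k

lemma cyclic_iff (hS : S.IsGeneralizedQuasiSasaki) :
    (∀ X Y Z, S.canonicalTorsion x X Y Z + S.canonicalTorsion x Y Z X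
      + S.canonicalTorsion x Z X Y = 0) ↔ F.intrinsicTorsion ∈ U2Model.W7 := by
  rw [intrinsicTorsion, ← (F.isQuasiSasakiForms hS).cyclic_iff]
  constructor
  · intro h i j k
    rw [← F.canonicalTorsion_e, ← F.canonicalTorsion_e, ← F.canonicalTorsion_e, h]
  · intro h X Y Z
    have h2 : S.canonicalTorsion x Y Z X = ∑ i, ∑ j, ∑ k, inner ℝ (F.e i x) X *
        inner ℝ (F.e j x) Y * inner ℝ (F.e k x) Z *
        U2Model.torsionCoeff F.connectionForms j k i := by
      rw [F.canonicalTorsion_eq_sum Y Z X, Finset.sum_comm_cycle]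
      refine Finset.sum_congr rfl fun i _ ↦ Finset.sum_congr rfl fun j _ ↦
        Finset.sum_congr rfl fun k _ ↦ by ring
    have h3 : S.canonicalTorsion x Z X Y = ∑ i, ∑ j, ∑ k, inner ℝ (F.e i x) X *
        inner ℝ (F.e j x) Y * inner ℝ (F.e k x) Z *
        U2Model.torsionCoeff F.connectionForms k i j := by
      rw [F.canonicalTorsion_eq_sum Z X Y, ← Finset.sum_comm_cycle]
      refine Finset.sum_congr rfl fun i _ ↦ Finset.sum_congr rfl fun j _ ↦
        Finset.sum_congr rfl fun k _ ↦ by ring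
    rw [F.canonicalTorsion_eq_sum X Y Z, h2, h3]
    simp only [← Finset.sum_add_distrib]
    refine Finset.sum_eq_zero fun i _ ↦ Finset.sum_eq_zero fun j _ ↦
      Finset.sum_eq_zero fun k _ ↦ ?_
    linear_combination (inner ℝ (F.e i x) X * inner ℝ (F.e j x) Y * inner ℝ (F.e k x) Z) * h i j k

end AdaptedFrame

/-- The torsion of the canonical connection of a generalized quasi-Sasaki manifold is traceless. -/
lemma IsGeneralizedQuasiSasaki.sum_canonicalTorsion (hS : S.IsGeneralizedQuasiSasaki) {x : M}
    (e : OrthonormalBasis (Fin 5) ℝ (TangentSpace (𝓡 5) x)) (X : TangentSpace (𝓡 5) x) :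
    ∑ i, S.canonicalTorsion x X (e i) (e i) = 0 := by
  obtain ⟨F⟩ := S.nonempty_adaptedFrame x
  let A : TangentSpace (𝓡 5) x →ₗ[ℝ] TangentSpace (𝓡 5) x := S.canonicalConnection.torsion x X
  have htr (b : OrthonormalBasis (Fin 5) ℝ (TangentSpace (𝓡 5) x)) :
      ∑ i, S.canonicalTorsion x X (b i) (b i) = LinearMap.trace ℝ _ A := by
    rw [LinearMap.trace_eq_sum_inner A b]
    exact Finset.sum_congr rfl fun i _ ↦ real_inner_comm _ _
  rw [htr, ← htr (F.basis F.mem_domain)]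
  have h (i : Fin 5) : S.canonicalTorsion x X (F.e i x) (F.e i x) =
      ∑ j, inner ℝ (F.e j x) X * U2Model.torsionCoeff F.connectionForms j i i := by
    conv_lhs => rw [← F.sum_inner_smul_e X]
    simp only [← F.canonicalTorsion_e, canonicalTorsion, map_sum, map_smul,
      sum_apply, smul_apply, sum_inner, inner_smul_left, RCLike.conj_to_real]
  simp only [F.basis_apply, h]
  rw [Finset.sum_comm]
  refine Finset.sum_eq_zero fun j _ ↦ ?_
  rw [← Finset.mul_sum, (F.isQuasiSasakiForms hS).sum_torsionCoeff, mul_zero]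

end AlmostContactMetric

end

theorem proposition2 {M : Type*} [TopologicalSpace M]
    [ChartedSpace (EuclideanSpace ℝ (Fin 5)) M] [IsManifold (𝓡 5) ∞ M]
    [RiemannianBundle (fun x : M ↦ TangentSpace (𝓡 5) x)]
    [IsContMDiffRiemannianBundle (𝓡 5) ∞ (EuclideanSpace ℝ (Fin 5))
      (fun x : M ↦ TangentSpace (𝓡 5) x)]
    (S : AlmostContactMetric (𝓡 5) M) (hS : S.IsGeneralizedQuasiSasaki) :
    (IsTotallySkewSymmetric S.canonicalTorsion ↔
      S.IsOfClass (U2Model.W3 ⊔ U2Model.W4 ⊔ U2Model.W5)) ∧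
    (IsTracelessCyclic S.canonicalTorsion ↔ S.IsOfClass U2Model.W7) := by
  refine ⟨⟨fun h x F ↦ (F.totallySkew_iff hS).1 (h x), fun h x ↦ ?_⟩,
    ⟨fun h x F ↦ (F.cyclic_iff hS).1 (h x).1, fun h x ↦ ?_⟩⟩
  · obtain ⟨F⟩ := S.nonempty_adaptedFrame x
    exact (F.totallySkew_iff hS).2 (h x F)
  · obtain ⟨F⟩ := S.nonempty_adaptedFrame x
    exact ⟨(F.cyclic_iff hS).2 (h x F), hS.sum_canonicalTorsion⟩
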